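/- For a positive integer $A$ write $a\sim A$ for $A\le a<2A$, $a\in\mathbb{Z}$. Let $q$ be a prime, let $a,h\in\mathbb{F}_q^\times$, let $M,N\le q/2$ be positive integers, and let $\boldsymbol\alpha=(\alpha_m)_{m\sim M}$ and $\boldsymbol\beta=(\beta_n)_{n\sim N}$ be arbitrary complex weights, with $\|\boldsymbol\alpha\|_\sigma=\bigl(\sum_{m\sim M}|\alpha_m|^\sigma\bigr)^{1/\sigma}$ and $\|\boldsymbol\alpha\|_\infty=\max_{m\sim M}|\alpha_m|$, and similarly for $\boldsymbol\beta$. Put $\mathbf{e}_q(k)=\exp(2\pi i k/q)$ and $$W_{a,q}(\boldsymbol\alpha,\boldsymbol\beta;h,M,N)=\sum_{m\sim M}\sum_{n\sim N}\alpha_m\beta_n\sum_{\substack{x\in\mathbb{F}_q\\ x^2=amn}}\mathbf{e}_q(hx).$$ Then $$|W_{a,q}(\boldsymbol\alpha,\boldsymbol\beta;h,M,N)|\le\|\boldsymbol\alpha\|_2\,\|\boldsymbol\beta\|_\infty^{1/3}\,\|\boldsymbol\beta\|_1^{2/3}\,q^{1/8+o(1)}M^{7/24}N^{1/8}\Bigl(\frac{M^{7/48}}{q^{1/16}}+1\Bigr)\Bigl(\frac{N^{7/48}}{q^{1/16}}+1\Bigr)$$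 and $$|W_{a,q}(\boldsymbol\alpha,\boldsymbol\beta;h,M,N)|\le\|\boldsymbol\alpha\|_2\,\|\boldsymbol\beta\|_1^{3/4}\,\|\boldsymbol\beta\|_\infty^{1/4}\,q^{1/8+o(1)}M^{5/16}N^{1/16}\Bigl(\frac{M^{3/16}}{q^{1/8}}+1\Bigr)\Bigl(\frac{N^{3/16}}{q^{1/8}}+1\Bigr).$$ Here $q^{o(1)}$ means: for every $\varepsilon>0$ there is $q_0(\varepsilon)$, depending only on $\varepsilon$, such that for all primes $q\ge q_0(\varepsilon)$ and all $a,h,M,N,\boldsymbol\alpha,\boldsymbol\beta$ as above both bounds hold with $q^{o(1)}$ replaced by $q^{\varepsilon}$. -/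

import Mathlib

noncomputable section

/-- The range `m ∼ M`, that is, the integers `m` with `M ≤ m < 2M`. -/
def dyadic (M : ℕ) : Finset ℕ := Finset.Ico M (2 * M)

/-- `‖α‖_σ = (∑_{m ∼ M} |α_m|^σ)^{1/σ}`, for a weight `α` on the range `m ∼ M`. Only the values of
`α` on that range matter. -/
def weightNorm (σ : ℝ) (M : ℕ) (α : ℕ → ℂ) : ℝ :=
  (∑ m ∈ dyadic M, ‖α m‖ ^ σ) ^ (1 / σ)

/-- `‖α‖_∞ = max_{m ∼ M} |α_m|`. -/
def weightSupNorm (M : ℕ) (α : ℕ → ℂ) : ℝ :=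
  ((dyadic M).sup fun m => ‖α m‖₊ : NNReal)

/-- `W_{a,q}(α, β; h, M, N) = ∑_{m ∼ M} ∑_{n ∼ N} α_m β_n ∑_{x ∈ 𝔽_q, x² = amn} e_q(hx)`, where
`e_q(k) = exp(2πik/q)` is the standard additive character `ZMod.stdAddChar` of `ℤ/qℤ`. -/
def weylSqrtSum (q : ℕ) [NeZero q] (a h : ZMod q) (α β : ℕ → ℂ) (M N : ℕ) : ℂ :=
  ∑ m ∈ dyadic M, ∑ n ∈ dyadic N, α m * β n *
    ∑ x : ZMod q with x ^ 2 = a * (m : ZMod q) * (n : ZMod q), ZMod.stdAddChar (h * x)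

end

/-! If `u² = cam` and `v² = c⁻¹n`, then `x = uv` solves `x² = amn`; as `c` runs over the nonzero
residues, each solution `x` arises `q - 1` times. So the sum `W` is the average over `c` of bilinear
forms `∑ A_u B_v e_q(huv)`, where `A` and `B` are the weights carried over to square roots modulo
`q`, and it suffices to bound each form (`norm_weylSqrtSum_le_of_forall`).

Three applications of Cauchy–Schwarz and the fourth moment of a Fourier transform bound the eighth
power of the form by `‖A‖₂⁸ ‖B‖₁⁴ q E(B) E(1_U)`, where `U` contains the support of `A` and `E` is
the additive energy, that is, the sum of the squares of `autocorr` (`norm_bilinear_pow_eight_le`).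

The energies depend on how often a `t ≠ 0` is a difference of square roots of `bn` and `bn'`. With
`x = n' - n`, `y = n' + n` and `s = t²/b` this counts points of the parabola `x² = 2sy - s²` in a
box of side about `N`. There are two estimates, each up to `q^ε`. For each `t` the count is at most
`N²/q + √N`, by Weyl differencing (`card_parabolaSet_le`). This gives the second bound. The fourth
moment over `t` is at most `N²(1 + N³/q)^(3/2) + N³` (`sum_rootDiffCount_pow_four_le`). Differences
of pairs of points lie in the lattice `u ≡ 2sw`, which has few points in the box unless `2s ≡ u/w`
with `u`, `w` small, and this happens for few `s`. This gives the first bound. -/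

/-! ### The divisor bound. -/

/-- The divisor function grows slower than any power. -/
lemma exists_card_divisors_le (ε : ℝ) (hε : 0 < ε) :
    ∃ C : ℝ, 1 ≤ C ∧ ∀ n : ℕ, n ≠ 0 → (n.divisors.card : ℝ) ≤ C * (n : ℝ) ^ ε := by
  have hlog : 0 < Real.log 2 := Real.log_pos one_lt_two
  -- Chosen so that `a + 1 ≤ C₀ (1 + ε a log 2)`; then `1 + x ≤ exp x` covers every prime.
  set C₀ : ℝ := 1 + 1 / (ε * Real.log 2) with hC₀
  have hC₀1 : 1 ≤ C₀ := by
    have : 0 ≤ 1 / (ε * Real.log 2) := by positivity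
    linarith
  -- Primes `p ≥ P` satisfy `p ^ ε ≥ 2`, so `a + 1 ≤ 2 ^ a` suffices for them and the factor `C₀` is
  -- paid at most `P` times.
  set P : ℕ := ⌈(2 : ℝ) ^ (1 / ε)⌉₊ with hP
  have hsmall : ∀ p a : ℕ, p.Prime → ((a : ℝ) + 1) ≤ C₀ * ((p : ℝ) ^ a) ^ ε := by
    intro p a hp
    have h2 : ((2 : ℝ) ^ a) ^ ε ≤ ((p : ℝ) ^ a) ^ ε := by
      have : (2 : ℝ) ≤ p := by exact_mod_cast hp.two_le
      gcongr
    have h1 : ((2 : ℝ) ^ a) ^ ε = Real.exp (ε * a * Real.log 2) := by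
      rw [Real.rpow_def_of_pos (by positivity), Real.log_pow]; congr 1; ring
    have h3 := Real.add_one_le_exp (ε * a * Real.log 2)
    have h4 : ((a : ℝ) + 1) ≤ C₀ * (ε * a * Real.log 2 + 1) := by
      have : C₀ * (ε * a * Real.log 2 + 1)
          = (a : ℝ) + 1 + ε * a * Real.log 2 + 1 / (ε * Real.log 2) := by
        rw [hC₀]; field_simp; ring
      rw [this]
      have : 0 ≤ ε * a * Real.log 2 := by positivity
      have : 0 ≤ 1 / (ε * Real.log 2) := by positivity
      linarith
    calc _ ≤ _ := h4
      _ ≤ C₀ * ((2 : ℝ) ^ a) ^ ε := by rw [h1]; gcongr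
      _ ≤ _ := by gcongr
  have hlarge : ∀ p a : ℕ, P ≤ p → ((a : ℝ) + 1) ≤ ((p : ℝ) ^ a) ^ ε := by
    intro p a hp
    have h0 : (2 : ℝ) ^ (1 / ε) ≤ p := (Nat.le_ceil _).trans (by exact_mod_cast hp)
    have h1 : (2 : ℝ) ≤ (p : ℝ) ^ ε := by
      calc (2 : ℝ) = ((2 : ℝ) ^ (1 / ε)) ^ ε := by
            rw [← Real.rpow_mul (by norm_num)]; field_simp; simp
        _ ≤ _ := by gcongr
    have h2 : ((p : ℝ) ^ a) ^ ε = ((p : ℝ) ^ ε) ^ a := by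
      rw [← Real.rpow_natCast, ← Real.rpow_natCast, ← Real.rpow_mul (by positivity),
        ← Real.rpow_mul (by positivity), mul_comm]
    rw [h2]
    calc ((a : ℝ) + 1) ≤ 2 ^ a := by exact_mod_cast Nat.lt_two_pow_self
      _ ≤ _ := by gcongr
  refine ⟨C₀ ^ P, one_le_pow₀ hC₀1, fun n hn => ?_⟩
  have hn' : (n : ℝ) ^ ε = ∏ p ∈ n.primeFactors, ((p : ℝ) ^ n.factorization p) ^ ε := by
    conv_lhs => rw [← Nat.prod_factorization_pow_eq_self hn]
    rw [Finsupp.prod, Nat.cast_prod, Nat.support_factorization,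
      ← Real.finsetProd_rpow _ _ (fun _ _ => by positivity)]
    simp
  rw [Nat.card_divisors hn, hn']
  push_cast
  have key : ∀ p ∈ n.primeFactors, ((n.factorization p : ℝ) + 1) ≤
      (if p < P then C₀ else 1) * ((p : ℝ) ^ n.factorization p) ^ ε := by
    intro p hp
    split_ifs with h
    · exact hsmall p _ (Nat.prime_of_mem_primeFactors hp)
    · rw [one_mul]; exact hlarge p _ (not_lt.1 h)
  refine (Finset.prod_le_prod (fun _ _ => by positivity) key).trans ?_
  rw [Finset.prod_mul_distrib]
  gcongr
  rw [Finset.prod_ite, Finset.prod_const, Finset.prod_const_one, mul_one]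
  refine pow_le_pow_right₀ hC₀1 ?_
  calc _ ≤ (Finset.range P).card := Finset.card_le_card fun p hp => by
        simpa using (Finset.mem_filter.1 hp).2
    _ = P := Finset.card_range P

/-! ### Lattice points in a box. -/

/-- Lattice points of a box `|u| ≤ X`, `|w| ≤ Y`. -/
noncomputable def latticeBox (Λ : AddSubgroup (ℤ × ℤ)) (X Y : ℕ) : Finset (ℤ × ℤ) :=
  open Classical in
  (Finset.Icc (-(X : ℤ)) X ×ˢ Finset.Icc (-(Y : ℤ)) Y).filter (· ∈ Λ)

lemma mem_latticeBox {Λ : AddSubgroup (ℤ × ℤ)} {X Y : ℕ} {p : ℤ × ℤ} :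
    p ∈ latticeBox Λ X Y ↔ |p.1| ≤ X ∧ |p.2| ≤ Y ∧ p ∈ Λ := by
  simp only [latticeBox, Finset.mem_filter, Finset.mem_product, Finset.mem_Icc, abs_le]
  tauto

/-- A finite set of integers with gaps at least `G` in `[-X, X]`, `G ≤ X`, has at most `4X/G`
elements. -/
lemma card_le_of_gap {S : Finset ℤ} {X G : ℕ} (hG : 0 < G) (hGX : G ≤ X)
    (hS : ∀ x ∈ S, |x| ≤ X) (hgap : ∀ x ∈ S, ∀ y ∈ S, x ≠ y → (G : ℤ) ≤ |x - y|) :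
    (S.card : ℝ) ≤ 4 * X / G := by
  have hG' : (0 : ℤ) < G := by exact_mod_cast hG
  have hmaps : Set.MapsTo (fun x : ℤ => x / G) S
      (Finset.Icc (-((X : ℤ) / G) - 1) ((X : ℤ) / G)) := by
    intro x hx
    have h := abs_le.1 (hS x hx)
    simp only [Finset.coe_Icc, Set.mem_Icc]
    constructor
    · have h1 : (X : ℤ) < ((X : ℤ) / G + 1) * G := Int.lt_ediv_add_one_mul_self _ hG'
      rw [Int.le_ediv_iff_mul_le hG']
      nlinarith
    · exact Int.ediv_le_ediv hG' h.2
  have hinj : Set.InjOn (fun x : ℤ => x / G) S := by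
    intro x hx y hy hxy
    by_contra hne
    have h := hgap x hx y hy hne
    simp only at hxy
    have h1 := Int.emod_add_mul_ediv x G
    have h2 := Int.emod_add_mul_ediv y G
    have h3 := Int.emod_nonneg x hG'.ne'
    have h4 := Int.emod_nonneg y hG'.ne'
    have h5 := Int.emod_lt_of_pos x hG'
    have h6 := Int.emod_lt_of_pos y hG'
    rw [hxy] at h1
    have : |x - y| < G := by rw [abs_lt]; constructor <;> linarith
    linarith
  have hcard := Finset.card_le_card_of_injOn _ hmaps hinj
  rw [Int.card_Icc] at hcard
  have h1 : (1 : ℤ) ≤ (X : ℤ) / G := by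
    rw [Int.le_ediv_iff_mul_le hG']; exact_mod_cast (by simpa using hGX)
  -- With `k = ⌊X/G⌋` the quotients take at most `2k + 2` values, and `2k + 2 ≤ 4k` because `k ≥ 1`.
  have h2 : (S.card : ℤ) ≤ 4 * ((X : ℤ) / G) := by omega
  have h3 : (((X : ℤ) / (G : ℤ) : ℤ) : ℝ) ≤ (X : ℝ) / G := by
    rw [le_div_iff₀ (by exact_mod_cast hG)]
    exact_mod_cast Int.ediv_mul_le (X : ℤ) hG'.ne'
  have h4 : (S.card : ℝ) ≤ 4 * (((X : ℤ) / (G : ℤ) : ℤ) : ℝ) := by exact_mod_cast h2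
  calc _ ≤ _ := h4
    _ ≤ 4 * ((X : ℝ) / G) := by gcongr
    _ = _ := by ring

/-- The determinant against `g` is a multiple of `q`, hence takes few values on the box; points
sharing a value differ by a vector parallel to `g`, and minimality keeps their abscissae at least
`|g.1|` apart. The relevant norm is `max (|u| Y) (|w| X)`: `hle` says that the first coordinate of
`g` realises it, and `hmin` is the minimality of `g`. -/
lemma card_latticeBox_le_of_min {Λ : AddSubgroup (ℤ × ℤ)} {q X Y : ℕ} (hq : 0 < q)
    (hX : 0 < X) (hY : 0 < Y)
    (hdet : ∀ p ∈ Λ, ∀ p' ∈ Λ, (q : ℤ) ∣ p.1 * p'.2 - p.2 * p'.1)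
    {g : ℤ × ℤ} (hg : g ∈ latticeBox Λ X Y) (hg0 : g.1 ≠ 0)
    (hmin : ∀ p ∈ latticeBox Λ X Y, p ≠ 0 → |p.1| * Y < |g.1| * Y → |g.1| * Y ≤ |p.2| * X)
    (hle : |g.2| * X ≤ |g.1| * Y) :
    ((latticeBox Λ X Y).card : ℝ) ≤ 16 * X * Y / q + 4 * X / |(g.1 : ℝ)| := by
  obtain ⟨hg1, hg2, hgΛ⟩ := mem_latticeBox.1 hg
  have hq' : (0 : ℤ) < q := by exact_mod_cast hq
  have hY' : (0 : ℤ) < Y := by exact_mod_cast hY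
  have hX' : (0 : ℤ) < X := by exact_mod_cast hX
  set G : ℕ := g.1.natAbs with hG
  have hGabs : (G : ℤ) = |g.1| := by simp [hG]
  have hGpos : 0 < G := Int.natAbs_pos.2 hg0
  have hGX : G ≤ X := by exact_mod_cast hGabs ▸ hg1
  set f : ℤ × ℤ → ℤ := fun p => (g.1 * p.2 - g.2 * p.1) / q with hf
  set T : ℤ := 2 * (G * Y) / q with hT
  have hfmul : ∀ p ∈ Λ, q * f p = g.1 * p.2 - g.2 * p.1 := fun p hp =>
    Int.mul_ediv_cancel' (hdet g hgΛ p hp)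
  have hmaps : ∀ p ∈ latticeBox Λ X Y, f p ∈ Finset.Icc (-T) T := by
    intro p hp
    obtain ⟨hp1, hp2, hpΛ⟩ := mem_latticeBox.1 hp
    have h1 := hfmul p hpΛ
    have h2 : |(q : ℤ) * f p| ≤ 2 * (G * Y) := by
      rw [h1]
      calc _ ≤ |g.1 * p.2| + |g.2 * p.1| := abs_sub _ _
        _ = |g.1| * |p.2| + |g.2| * |p.1| := by rw [abs_mul, abs_mul]
        _ ≤ |g.1| * Y + |g.2| * X := by gcongr
        _ ≤ 2 * (G * Y) := by rw [hGabs]; linarith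
    rw [abs_mul, abs_of_pos hq'] at h2
    rw [Finset.mem_Icc, ← abs_le, hT, Int.le_ediv_iff_mul_le hq']
    linarith
  have hfib : ∀ j ∈ Finset.Icc (-T) T,
      (((latticeBox Λ X Y).filter (f · = j)).card : ℝ) ≤ 4 * X / G := by
    intro j _
    have hgapw : ∀ p ∈ (latticeBox Λ X Y).filter (f · = j),
        ∀ p' ∈ (latticeBox Λ X Y).filter (f · = j), p ≠ p' → (G : ℤ) ≤ |p.1 - p'.1| := by
      intro p hp p' hp' hne
      rw [Finset.mem_filter] at hp hp'
      obtain ⟨hp1, hp2, hpΛ⟩ := mem_latticeBox.1 hp.1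
      obtain ⟨hp1', hp2', hpΛ'⟩ := mem_latticeBox.1 hp'.1
      -- Equal determinants against `g` make `p - p'` parallel to `g`.
      have hdet0 : g.1 * (p.2 - p'.2) = g.2 * (p.1 - p'.1) := by
        have h1 := hfmul p hpΛ
        have h2 := hfmul p' hpΛ'
        rw [hp.2] at h1; rw [hp'.2] at h2
        linarith
      by_contra hlt
      rw [not_le, hGabs] at hlt
      have habs : |g.1| * |p.2 - p'.2| = |g.2| * |p.1 - p'.1| := by
        rw [← abs_mul, ← abs_mul, hdet0]
      have hgpos : 0 < |g.1| := abs_pos.2 hg0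
      have hle2 : |p.2 - p'.2| ≤ |g.2| := by
        by_contra hh
        rw [not_le] at hh
        have : |g.2| * |p.1 - p'.1| ≤ |g.2| * |g.1| := by gcongr
        nlinarith
      -- The difference is a nonzero lattice point of the box, parallel to `g` and shorter than it.
      have hmem : p - p' ∈ latticeBox Λ X Y := mem_latticeBox.2
        ⟨(hlt.le.trans hg1), hle2.trans hg2, Λ.sub_mem hpΛ hpΛ'⟩
      have h3 := hmin (p - p') hmem (sub_ne_zero.2 hne) (by
        simp only [Prod.fst_sub]; gcongr)
      simp only [Prod.snd_sub] at h3
      rcases eq_or_ne g.2 0 with h0 | h0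
      · rw [h0, abs_zero, abs_nonpos_iff] at hle2
        rw [hle2] at h3
        simp only [abs_zero, zero_mul] at h3
        have : 0 < |g.1| * Y := by positivity
        linarith
      · have hg2pos : 0 < |g.2| := abs_pos.2 h0
        have hlt2 : |p.2 - p'.2| < |g.2| := by
          by_contra hh
          rw [not_lt] at hh
          have : |g.2| * |p.1 - p'.1| < |g.2| * |g.1| := by gcongr
          nlinarith
        have : |p.2 - p'.2| * X < |g.2| * X := by gcongr
        linarith
    have hinj : Set.InjOn Prod.fst (((latticeBox Λ X Y).filter (f · = j) : Finset (ℤ × ℤ)) :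
        Set (ℤ × ℤ)) := by
      intro p hp p' hp' h
      by_contra hne
      have := hgapw p hp p' hp' hne
      rw [h, sub_self, abs_zero] at this
      have : (0 : ℤ) < G := by exact_mod_cast hGpos
      linarith
    rw [← Finset.card_image_of_injOn hinj]
    refine card_le_of_gap hGpos hGX ?_ ?_
    · intro x hx
      obtain ⟨p, hp, rfl⟩ := Finset.mem_image.1 hx
      exact (mem_latticeBox.1 (Finset.mem_filter.1 hp).1).1
    · intro x hx y hy hxy
      obtain ⟨p, hp, rfl⟩ := Finset.mem_image.1 hx
      obtain ⟨p', hp', rfl⟩ := Finset.mem_image.1 hy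
      exact hgapw p hp p' hp' fun h => hxy (by rw [h])
  have hT0 : 0 ≤ T := by positivity
  have hcardIcc : ((Finset.Icc (-T) T).card : ℝ) ≤ 4 * (G * Y) / q + 1 := by
    rw [Int.card_Icc]
    have h1 : (((T + 1 - -T).toNat : ℤ) : ℝ) = 2 * (T : ℝ) + 1 := by
      rw [Int.toNat_of_nonneg (by linarith)]; push_cast; ring
    have h2 : (T : ℝ) ≤ 2 * (G * Y) / q := by
      rw [le_div_iff₀ (by exact_mod_cast hq)]
      have h3 : T * q ≤ 2 * ((G : ℤ) * Y) := Int.ediv_mul_le _ hq'.ne'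
      exact_mod_cast h3
    rw [Int.cast_natCast] at h1
    rw [h1]
    calc _ ≤ 2 * (2 * ((G : ℝ) * Y) / q) + 1 := by gcongr
      _ = _ := by ring
  have hGR : |(g.1 : ℝ)| = G := by
    rw [← Int.cast_abs, ← hGabs]; simp
  rw [hGR, Finset.card_eq_sum_card_fiberwise hmaps]
  push_cast
  calc _ ≤ ∑ j ∈ Finset.Icc (-T) T, (4 * (X : ℝ) / G) := Finset.sum_le_sum hfib
    _ = (Finset.Icc (-T) T).card * (4 * (X : ℝ) / G) := by rw [Finset.sum_const, nsmul_eq_mul]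
    _ ≤ (4 * (G * Y) / q + 1) * (4 * (X : ℝ) / G) := by gcongr
    _ = _ := by
      have : (G : ℝ) ≠ 0 := by exact_mod_cast hGpos.ne'
      have : (q : ℝ) ≠ 0 := by exact_mod_cast hq.ne'
      field_simp
      ring

/-- A planar lattice all of whose determinants are divisible by `q` has few points in a box, unless
it has a short vector. -/
lemma exists_card_latticeBox_le {Λ : AddSubgroup (ℤ × ℤ)} {q X Y : ℕ} (hq : 0 < q)
    (hX : 0 < X) (hY : 0 < Y)
    (hdet : ∀ p ∈ Λ, ∀ p' ∈ Λ, (q : ℤ) ∣ p.1 * p'.2 - p.2 * p'.1)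
    (hcard : 1 < (latticeBox Λ X Y).card) :
    ∃ g ∈ latticeBox Λ X Y, g ≠ 0 ∧
      ((latticeBox Λ X Y).card : ℝ) ≤
        16 * X * Y / q + 4 * X * Y / max (|(g.1 : ℝ)| * Y) (|(g.2 : ℝ)| * X) := by
  have hY' : (0 : ℤ) < Y := by exact_mod_cast hY
  have hX' : (0 : ℤ) < X := by exact_mod_cast hX
  have hYR : (0 : ℝ) < Y := by exact_mod_cast hY
  have hXR : (0 : ℝ) < X := by exact_mod_cast hX
  obtain ⟨p₀, hp₀, hp₀0⟩ := Finset.exists_mem_ne hcard 0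
  obtain ⟨g, hg, hgmin⟩ := Finset.exists_min_image ((latticeBox Λ X Y).filter (· ≠ 0))
    (fun p => max (|p.1| * Y) (|p.2| * X)) ⟨p₀, Finset.mem_filter.2 ⟨hp₀, hp₀0⟩⟩
  rw [Finset.mem_filter] at hg
  refine ⟨g, hg.1, hg.2, ?_⟩
  rcases le_total (|g.2| * X) (|g.1| * Y) with hle | hle
  · have hg0 : g.1 ≠ 0 := by
      intro h
      apply hg.2
      rw [h, abs_zero, zero_mul] at hle
      have : |g.2| = 0 := by
        have := abs_nonneg g.2
        nlinarith
      exact Prod.ext h (abs_eq_zero.1 this)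
    have hleR : |(g.2 : ℝ)| * X ≤ |(g.1 : ℝ)| * Y := by exact_mod_cast hle
    refine (card_latticeBox_le_of_min hq hX hY hdet hg.1 hg0 ?_ hle).trans_eq ?_
    · intro p hp hp0 hlt
      have h := hgmin p (Finset.mem_filter.2 ⟨hp, hp0⟩)
      rw [max_eq_left hle] at h
      rcases le_max_iff.1 h with h | h
      · exact absurd hlt (not_lt.2 h)
      · exact h
    · rw [max_eq_left hleR]
      have : |(g.1 : ℝ)| ≠ 0 := by simpa using hg0
      field_simp
  -- Exchanging the coordinates reduces this case to the previous one.
  · set Λ' : AddSubgroup (ℤ × ℤ) := Λ.comap (AddEquiv.prodComm (M := ℤ) (N := ℤ)).toAddMonoidHom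
      with hΛ'
    have hmemΛ' : ∀ p : ℤ × ℤ, p ∈ Λ' ↔ p.swap ∈ Λ := fun p => by
      rw [hΛ', AddSubgroup.mem_comap]; rfl
    have hswap : ∀ p : ℤ × ℤ, p ∈ latticeBox Λ' Y X ↔ p.swap ∈ latticeBox Λ X Y := fun p => by
      rw [mem_latticeBox, mem_latticeBox, hmemΛ']; simp only [Prod.fst_swap, Prod.snd_swap]; tauto
    have hcardeq : (latticeBox Λ X Y).card = (latticeBox Λ' Y X).card := by
      refine Finset.card_bij' (fun p _ => p.swap) (fun p _ => p.swap) ?_ ?_ ?_ ?_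
      · intro p hp; rw [hswap]; simpa using hp
      · intro p hp; exact (hswap p).1 hp
      · intro p _; simp
      · intro p _; simp
    have hg0 : g.2 ≠ 0 := by
      intro h
      apply hg.2
      rw [h, abs_zero, zero_mul] at hle
      have : |g.1| = 0 := by
        have := abs_nonneg g.1
        nlinarith
      exact Prod.ext (abs_eq_zero.1 this) h
    have hleR : |(g.1 : ℝ)| * Y ≤ |(g.2 : ℝ)| * X := by exact_mod_cast hle
    have hdet' : ∀ p ∈ Λ', ∀ p' ∈ Λ', (q : ℤ) ∣ p.1 * p'.2 - p.2 * p'.1 := by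
      intro p hp p' hp'
      have := hdet p.swap ((hmemΛ' p).1 hp) p'.swap ((hmemΛ' p').1 hp')
      rw [← dvd_neg, neg_sub]
      exact this
    rw [hcardeq]
    refine (card_latticeBox_le_of_min (g := g.swap) hq hY hX hdet' ((hswap _).2 (by simpa using hg.1))
      hg0 ?_ hle).trans_eq ?_
    · intro p hp hp0 hlt
      have h := hgmin p.swap (Finset.mem_filter.2 ⟨(hswap p).1 hp, fun h => hp0 (by
        simpa using congrArg Prod.swap h)⟩)
      rw [max_eq_right hle] at h
      rcases le_max_iff.1 h with h | h
      · exact h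
      · exact absurd hlt (not_lt.2 h)
    · rw [max_eq_right hleR]
      have : |(g.2 : ℝ)| ≠ 0 := by simpa using hg0
      rw [Prod.fst_swap]
      field_simp

/-! ### Points on a parabola modulo `q`, through lattices. -/

/-- The lattice of integer solutions of `u ≡ c w` modulo `q`. -/
def congruenceLattice (q : ℕ) (c : ZMod q) : AddSubgroup (ℤ × ℤ) where
  carrier := {p | (p.1 : ZMod q) = c * p.2}
  zero_mem' := by simp
  add_mem' := by
    intro p p' hp hp'
    simp only [Set.mem_ofPred_eq, Prod.fst_add, Prod.snd_add, Int.cast_add] at *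
    rw [hp, hp']; ring
  neg_mem' := by
    intro p hp
    simp only [Set.mem_ofPred_eq, Prod.fst_neg, Prod.snd_neg, Int.cast_neg] at *
    rw [hp]; ring

lemma mem_congruenceLattice {q : ℕ} {c : ZMod q} {p : ℤ × ℤ} :
    p ∈ congruenceLattice q c ↔ (p.1 : ZMod q) = c * p.2 := Iff.rfl

/-- Modulo `q` every vector of the lattice is a multiple of `(c, 1)`. -/
lemma dvd_det_of_mem_congruenceLattice {q : ℕ} {c : ZMod q} :
    ∀ p ∈ congruenceLattice q c, ∀ p' ∈ congruenceLattice q c,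
      (q : ℤ) ∣ p.1 * p'.2 - p.2 * p'.1 := by
  intro p hp p' hp'
  rw [mem_congruenceLattice] at hp hp'
  rw [← ZMod.intCast_zmod_eq_zero_iff_dvd]
  push_cast
  rw [hp, hp']; ring

/-- An integer `u ≠ 0` has at most `2 d(|u|)` divisors of either sign. -/
lemma card_le_two_mul_card_divisors {S : Finset ℤ} {u : ℤ} (hu : u ≠ 0) (hS : ∀ d ∈ S, d ∣ u) :
    S.card ≤ 2 * u.natAbs.divisors.card := by
  have hsub : S ⊆ u.natAbs.divisors.image (fun n : ℕ => (n : ℤ)) ∪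
      u.natAbs.divisors.image (fun n : ℕ => -(n : ℤ)) := by
    intro d hd
    have h1 : d.natAbs ∈ u.natAbs.divisors :=
      Nat.mem_divisors.2 ⟨Int.natAbs_dvd_natAbs.2 (hS d hd), Int.natAbs_ne_zero.2 hu⟩
    rw [Finset.mem_union, Finset.mem_image, Finset.mem_image]
    rcases Int.natAbs_eq d with h | h
    · exact Or.inl ⟨_, h1, h.symm⟩
    · exact Or.inr ⟨_, h1, h.symm⟩
  calc S.card ≤ _ := Finset.card_le_card hsub
    _ ≤ _ := Finset.card_union_le _ _
    _ ≤ u.natAbs.divisors.card + u.natAbs.divisors.card :=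
      add_le_add Finset.card_image_le Finset.card_image_le
    _ = _ := by ring

/-- The abscissae `|x| < N` of the points on the parabola `x² = 2sy - s²` modulo `q` with
`2N ≤ y < 4N`. -/
noncomputable def parabolaSet (q : ℕ) (s : ZMod q) (N : ℕ) : Finset ℤ :=
  open Classical in
  (Finset.Ioo (-(N : ℤ)) N).filter fun x =>
    ∃ y ∈ Finset.Ico (2 * (N : ℤ)) (4 * N), (x : ZMod q) ^ 2 = 2 * s * (y : ZMod q) - s ^ 2

lemma mem_parabolaSet {q : ℕ} {s : ZMod q} {N : ℕ} {x : ℤ} :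
    x ∈ parabolaSet q s N ↔ |x| < N ∧ ∃ y : ℤ, 2 * N ≤ y ∧ y < 4 * N ∧
      (x : ZMod q) ^ 2 = 2 * s * (y : ZMod q) - s ^ 2 := by
  simp [parabolaSet, abs_lt, and_assoc]

/-- Differences of points on the parabola lie in a lattice, and each lattice point arises from few
pairs. -/
lemma sq_card_parabolaSet_le {q N : ℕ} (hN : 0 < N) (hNq : 2 * N ≤ q) (s : ZMod q) {D : ℝ}
    (hD1 : 1 ≤ D) (hD : ∀ n : ℕ, n ≠ 0 → n ≤ q ^ 2 → (n.divisors.card : ℝ) ≤ D) :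
    ((parabolaSet q s N).card : ℝ) ^ 2 ≤
      8 * D * (latticeBox (congruenceLattice q (2 * s)) (N ^ 2) (2 * N)).card := by
  classical
  set S := parabolaSet q s N with hS
  set L := latticeBox (congruenceLattice q (2 * s)) (N ^ 2) (2 * N) with hL
  have hy : ∀ x : ℤ, ∃ y : ℤ, x ∈ S → 2 * N ≤ y ∧ y < 4 * N ∧
      (x : ZMod q) ^ 2 = 2 * s * (y : ZMod q) - s ^ 2 := by
    intro x
    by_cases hx : x ∈ S
    · obtain ⟨-, y, h⟩ := mem_parabolaSet.1 hx
      exact ⟨y, fun _ => h⟩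
    · exact ⟨0, fun h => absurd h hx⟩
  choose y hy using hy
  -- The pairs with `x₁² = x₂²` are set apart, since divisors can be counted only for a nonzero `x₁²
  -- - x₂²`; there are at most two such pairs for each `x₁`.
  set P₀ := (S ×ˢ S).filter fun p => p.1 ^ 2 = p.2 ^ 2 with hP₀
  set P₁ := (S ×ˢ S).filter fun p => ¬ p.1 ^ 2 = p.2 ^ 2 with hP₁
  have hsplit : S.card ^ 2 = P₀.card + P₁.card := by
    rw [sq, ← Finset.card_product, hP₀, hP₁, Finset.card_filter_add_card_filter_not]
  have hP₀card : P₀.card ≤ 2 * S.card := by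
    refine Finset.card_le_mul_card_image_of_maps_to (f := Prod.fst) (t := S) ?_ 2 ?_
    · intro p hp
      exact (Finset.mem_product.1 (Finset.mem_filter.1 hp).1).1
    · intro x _
      refine (Finset.card_le_card (t := {(x, x), (x, -x)}) ?_).trans Finset.card_le_two
      rintro ⟨x₁, x₂⟩ hp
      simp only [hP₀, Finset.mem_filter] at hp
      obtain ⟨⟨-, h⟩, rfl⟩ := hp
      rcases sq_eq_sq_iff_eq_or_eq_neg.1 h with h | h
      · simp [h]
      · simp [h]
  have hP₁card : (P₁.card : ℝ) ≤ 2 * D * L.card := by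
    set φ : ℤ × ℤ → ℤ × ℤ := fun p => (p.1 ^ 2 - p.2 ^ 2, y p.1 - y p.2) with hφ
    have hmaps : ∀ p ∈ P₁, φ p ∈ L := by
      rintro ⟨x₁, x₂⟩ hp
      simp only [hP₁, Finset.mem_filter, Finset.mem_product] at hp
      obtain ⟨⟨h1, h2⟩, -⟩ := hp
      obtain ⟨a1, b1, c1⟩ := hy x₁ h1
      obtain ⟨a2, b2, c2⟩ := hy x₂ h2
      have hx1 := (mem_parabolaSet.1 h1).1
      have hx2 := (mem_parabolaSet.1 h2).1
      have hs1 : x₁ ^ 2 ≤ (N : ℤ) ^ 2 := sq_le_sq.2 (by simpa using hx1.le)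
      have hs2 : x₂ ^ 2 ≤ (N : ℤ) ^ 2 := sq_le_sq.2 (by simpa using hx2.le)
      rw [hL, mem_latticeBox, mem_congruenceLattice]
      refine ⟨?_, ?_, ?_⟩
      · simp only [hφ, abs_le]; push_cast
        constructor <;> nlinarith [sq_nonneg x₁, sq_nonneg x₂]
      · simp only [hφ, abs_le]; push_cast
        constructor <;> linarith
      · simp only [hφ]; push_cast
        rw [c1, c2]; ring
    rw [Finset.card_eq_sum_card_fiberwise hmaps]
    push_cast
    have hfib : ∀ z ∈ L, ((P₁.filter (φ · = z)).card : ℝ) ≤ 2 * D := by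
      intro z hz
      rcases Finset.eq_empty_or_nonempty (P₁.filter (φ · = z)) with h0 | ⟨p₀, hp₀⟩
      · rw [h0]; simp; linarith
      have hz0 : z.1 ≠ 0 := by
        simp only [hP₁, hφ, Finset.mem_filter] at hp₀
        rw [← hp₀.2]
        exact sub_ne_zero.2 hp₀.1.2
      -- Since `z.1 = (x₁ - x₂)(x₁ + x₂)` is nonzero, the divisor `x₁ - x₂` of `z.1` determines the
      -- pair.
      have hinj : Set.InjOn (fun p : ℤ × ℤ => p.1 - p.2) (P₁.filter (φ · = z) : Finset (ℤ × ℤ)) := by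
        intro p hp p' hp' h
        simp only [Finset.coe_filter, Set.mem_ofPred_eq, hφ] at hp hp' h
        have e1 : p.1 ^ 2 - p.2 ^ 2 = z.1 := by rw [← hp.2]
        have e2 : p'.1 ^ 2 - p'.2 ^ 2 = z.1 := by rw [← hp'.2]
        have e3 : (p.1 - p.2) * (p.1 + p.2) = z.1 := by rw [← e1]; ring
        have e4 : (p.1 - p.2) * (p'.1 + p'.2) = z.1 := by rw [← e2, h]; ring
        have hne : p.1 - p.2 ≠ 0 := by
          intro h0; rw [h0, zero_mul] at e3; exact hz0 e3.symm
        have e5 : p.1 + p.2 = p'.1 + p'.2 := mul_left_cancel₀ hne (e3.trans e4.symm)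
        exact Prod.ext (by omega) (by omega)
      have h1 := card_le_two_mul_card_divisors (S := (P₁.filter (φ · = z)).image
        fun p : ℤ × ℤ => p.1 - p.2) hz0 (by
          intro d hd
          obtain ⟨p, hp, rfl⟩ := Finset.mem_image.1 hd
          have e1 : p.1 ^ 2 - p.2 ^ 2 = z.1 := by rw [← (Finset.mem_filter.1 hp).2]
          exact ⟨p.1 + p.2, by rw [← e1]; ring⟩)
      rw [Finset.card_image_of_injOn hinj] at h1
      have h2 : (z.1.natAbs.divisors.card : ℝ) ≤ D := by
        refine hD _ (Int.natAbs_ne_zero.2 hz0) ?_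
        have h3 : z.1.natAbs ≤ N ^ 2 := by
          have := (mem_latticeBox.1 hz).1
          rw [Int.abs_eq_natAbs] at this
          exact_mod_cast this
        exact h3.trans (Nat.pow_le_pow_left (by omega) 2)
      calc ((P₁.filter (φ · = z)).card : ℝ) ≤ 2 * (z.1.natAbs.divisors.card : ℝ) := by
            exact_mod_cast h1
        _ ≤ _ := by gcongr
    calc _ ≤ ∑ z ∈ L, (2 * D) := Finset.sum_le_sum hfib
      _ = _ := by rw [Finset.sum_const, nsmul_eq_mul]; ring
  have hL1 : (1 : ℝ) ≤ L.card := by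
    have : 0 < L.card := Finset.card_pos.2 ⟨0, mem_latticeBox.2 ⟨by simp, by simp, zero_mem _⟩⟩
    exact_mod_cast this
  have hsplitR : (S.card : ℝ) ^ 2 ≤ 2 * S.card + 2 * D * L.card := by
    have h1 : (S.card : ℝ) ^ 2 = P₀.card + P₁.card := by exact_mod_cast hsplit
    have h2 : (P₀.card : ℝ) ≤ 2 * S.card := by exact_mod_cast hP₀card
    linarith
  have hDL : 1 ≤ D * L.card := one_le_mul_of_one_le_of_one_le hD1 hL1
  -- `2|S| ≤ |S|²/2 + 2` absorbs the linear term, and `1 ≤ D|L|` absorbs the constant.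
  nlinarith [sq_nonneg ((S.card : ℝ) - 2)]

/-- Either few points lie on the parabola, or `2s` is a quotient of small integers. -/
lemma card_parabolaSet_dichotomy {q N : ℕ} [Fact q.Prime] (hq2 : q ≠ 2) (hN : 0 < N)
    (hNq : 2 * N ≤ q) {s : ZMod q} (hs : s ≠ 0) {D : ℝ}
    (hD1 : 1 ≤ D) (hD : ∀ n : ℕ, n ≠ 0 → n ≤ q ^ 2 → (n.divisors.card : ℝ) ≤ D) :
    ((parabolaSet q s N).card : ℝ) ^ 2 ≤ 8 * D * (1 + 64 * N ^ 3 / q) ∨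
      ∃ u w : ℤ, u ≠ 0 ∧ (w : ZMod q) ≠ 0 ∧ |u| ≤ (N ^ 2 : ℕ) ∧ |w| ≤ (2 * N : ℕ) ∧
        (u : ZMod q) = 2 * s * w ∧
        ((parabolaSet q s N).card : ℝ) ^ 4 ≤ 8192 * D ^ 2 * N ^ 3 / (|(u : ℝ)| * |(w : ℝ)|) := by
  have hq : q.Prime := Fact.out
  have hqR : (0 : ℝ) < q := by exact_mod_cast hq.pos
  have hNR : (0 : ℝ) < N := by exact_mod_cast hN
  have hN1 : (1 : ℝ) ≤ N := by exact_mod_cast hN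
  have h2s : 2 * s ≠ 0 := by
    refine mul_ne_zero ?_ hs
    have : ((2 : ℕ) : ZMod q) ≠ 0 := by
      rw [Ne, ZMod.natCast_eq_zero_iff]
      exact fun h => hq2 ((Nat.prime_dvd_prime_iff_eq hq Nat.prime_two).1 h)
    exact_mod_cast this
  have hI := sq_card_parabolaSet_le hN hNq s hD1 hD
  set I : ℝ := ((parabolaSet q s N).card : ℝ) with hIdef
  set L := latticeBox (congruenceLattice q (2 * s)) (N ^ 2) (2 * N) with hL
  have hbase : (0 : ℝ) ≤ 64 * N ^ 3 / q := by positivity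
  rcases le_or_gt L.card 1 with h1 | h1
  · left
    have h1' : (L.card : ℝ) ≤ 1 := by exact_mod_cast h1
    refine hI.trans ?_
    gcongr; linarith
  obtain ⟨g, hg, hg0, hcard⟩ := exists_card_latticeBox_le hq.pos (by positivity) (by positivity)
    dvd_det_of_mem_congruenceLattice h1
  obtain ⟨hg1, hg2, hgΛ⟩ := mem_latticeBox.1 hg
  rw [mem_congruenceLattice] at hgΛ
  rw [← hL] at hcard
  push_cast at hcard
  set m : ℝ := max (|(g.1 : ℝ)| * (2 * N)) (|(g.2 : ℝ)| * N ^ 2) with hm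
  -- Either the area term dominates, or the short vector does. In the latter case `4m < q`, so a
  -- coordinate of `g` vanishes modulo `q` only if it is zero.
  rcases le_or_gt (4 * (N : ℝ) ^ 2 * (2 * N) / m) (16 * (N : ℝ) ^ 2 * (2 * N) / q) with hc | hc
  · left
    refine hI.trans ?_
    gcongr
    have : 16 * (N : ℝ) ^ 2 * (2 * N) / q + 16 * N ^ 2 * (2 * N) / q = 64 * N ^ 3 / q := by ring
    linarith
  right
  have hm0 : 0 < m := by
    by_contra h
    have hm' : 0 ≤ m := le_max_of_le_left (by positivity)
    have : m = 0 := le_antisymm (not_lt.1 h) hm'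
    rw [this, div_zero] at hc
    have : 0 ≤ 16 * (N : ℝ) ^ 2 * (2 * N) / q := by positivity
    linarith
  have hmq : 4 * m < q := by
    rw [div_lt_div_iff₀ hqR hm0] at hc
    have h8 : (0 : ℝ) < 8 * N ^ 3 := by positivity
    nlinarith
  have hm1 : |(g.1 : ℝ)| * (2 * N) ≤ m := le_max_left _ _
  have hm2 : |(g.2 : ℝ)| * N ^ 2 ≤ m := le_max_right _ _
  have hg1q : |(g.1 : ℝ)| < q := by nlinarith [abs_nonneg (g.1 : ℝ)]
  have hg2q : |(g.2 : ℝ)| < q := by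
    have : |(g.2 : ℝ)| * 1 ≤ |(g.2 : ℝ)| * N ^ 2 := by gcongr; exact one_le_pow₀ hN1
    nlinarith [abs_nonneg (g.2 : ℝ)]
  have hsmall : ∀ z : ℤ, |(z : ℝ)| < q → (z : ZMod q) = 0 → z = 0 := by
    intro z hz h
    rw [ZMod.intCast_zmod_eq_zero_iff_dvd] at h
    exact Int.eq_zero_of_abs_lt_dvd h (by exact_mod_cast hz)
  have hw : (g.2 : ZMod q) ≠ 0 := by
    intro h
    have e2 := hsmall _ hg2q h
    rw [h, mul_zero] at hgΛ
    exact hg0 (Prod.ext (hsmall _ hg1q hgΛ) e2)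
  have hu : g.1 ≠ 0 := by
    intro h
    rw [h, Int.cast_zero] at hgΛ
    exact (mul_ne_zero h2s hw) hgΛ.symm
  have hw' : g.2 ≠ 0 := fun h => hw (by rw [h]; simp)
  refine ⟨g.1, g.2, hu, hw, hg1, hg2, hgΛ, ?_⟩
  have hupos : 0 < |(g.1 : ℝ)| := abs_pos.2 (by exact_mod_cast hu)
  have hwpos : 0 < |(g.2 : ℝ)| := abs_pos.2 (by exact_mod_cast hw')
  have hLm : (L.card : ℝ) ≤ 16 * N ^ 3 / m := by
    have : 4 * (N : ℝ) ^ 2 * (2 * N) / m + 4 * (N : ℝ) ^ 2 * (2 * N) / m = 16 * N ^ 3 / m := by ring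
    linarith
  -- A maximum is at least the geometric mean. The product `|u||w|` is what makes the later sum over
  -- pairs cost only logarithms.
  have hmm : 2 * (N : ℝ) ^ 3 * (|(g.1 : ℝ)| * |(g.2 : ℝ)|) ≤ m ^ 2 := by
    calc _ = (|(g.1 : ℝ)| * (2 * N)) * (|(g.2 : ℝ)| * N ^ 2) := by ring
      _ ≤ m * m := by gcongr
      _ = _ := by ring
  clear_value m I L
  calc I ^ 4 = (I ^ 2) ^ 2 := by ring
    _ ≤ (8 * D * (16 * N ^ 3 / m)) ^ 2 := by
      gcongr
      exact hI.trans (by gcongr)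
    _ = 16384 * D ^ 2 * N ^ 6 / m ^ 2 := by ring
    _ ≤ 16384 * D ^ 2 * N ^ 6 / (2 * (N : ℝ) ^ 3 * (|(g.1 : ℝ)| * |(g.2 : ℝ)|)) := by gcongr
    _ = _ := by field_simp; ring

/-! ### Differences of square roots and the fourth moment of their counts. -/

lemma sum_inv_abs_le (X : ℕ) :
    ∑ u ∈ (Finset.Icc (-(X : ℤ)) X).filter (· ≠ 0), |(u : ℝ)|⁻¹ ≤ 2 * (1 + Real.log X) := by
  have hsub : (Finset.Icc (-(X : ℤ)) X).filter (· ≠ 0) ⊆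
      (Finset.Icc 1 X).image (fun n : ℕ => (n : ℤ)) ∪
      (Finset.Icc 1 X).image (fun n : ℕ => -(n : ℤ)) := by
    intro d hd
    simp only [Finset.mem_filter, Finset.mem_Icc] at hd
    have h1 : d.natAbs ∈ Finset.Icc 1 X := by rw [Finset.mem_Icc]; omega
    rw [Finset.mem_union, Finset.mem_image, Finset.mem_image]
    rcases Int.natAbs_eq d with h | h
    · exact Or.inl ⟨_, h1, h.symm⟩
    · exact Or.inr ⟨_, h1, h.symm⟩
  have hharm : ∑ n ∈ Finset.Icc 1 X, ((n : ℝ))⁻¹ ≤ 1 + Real.log X := by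
    have := harmonic_le_one_add_log X
    rw [harmonic_eq_sum_Icc] at this
    push_cast at this
    exact this
  calc _ ≤ ∑ u ∈ (Finset.Icc 1 X).image (fun n : ℕ => (n : ℤ)) ∪
      (Finset.Icc 1 X).image (fun n : ℕ => -(n : ℤ)), |(u : ℝ)|⁻¹ :=
        Finset.sum_le_sum_of_subset_of_nonneg hsub fun _ _ _ => by positivity
    _ ≤ ∑ u ∈ (Finset.Icc 1 X).image (fun n : ℕ => (n : ℤ)), |(u : ℝ)|⁻¹ +
        ∑ u ∈ (Finset.Icc 1 X).image (fun n : ℕ => -(n : ℤ)), |(u : ℝ)|⁻¹ := by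
      rw [← Finset.sum_union_inter]
      exact le_add_of_nonneg_right (Finset.sum_nonneg fun _ _ => by positivity)
    _ = ∑ n ∈ Finset.Icc 1 X, ((n : ℝ))⁻¹ + ∑ n ∈ Finset.Icc 1 X, ((n : ℝ))⁻¹ := by
      rw [Finset.sum_image (by intro a _ b _ h; simpa using h),
        Finset.sum_image (by intro a _ b _ h; simpa using h)]
      simp
    _ ≤ _ := by linarith

section

variable {q : ℕ} [Fact q.Prime]

lemma two_ne_zero_zmod (hq2 : q ≠ 2) : (2 : ZMod q) ≠ 0 := by
  have hq : q.Prime := Fact.out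
  have : ((2 : ℕ) : ZMod q) ≠ 0 := by
    rw [Ne, ZMod.natCast_eq_zero_iff]
    exact fun h => hq2 ((Nat.prime_dvd_prime_iff_eq hq Nat.prime_two).1 h)
  exact_mod_cast this

lemma card_sqrt_le_two (c : ZMod q) : (Finset.univ.filter fun v : ZMod q => v ^ 2 = c).card ≤ 2 := by
  rcases Finset.eq_empty_or_nonempty (Finset.univ.filter fun v : ZMod q => v ^ 2 = c) with h | ⟨v, hv⟩
  · rw [h]; simp
  · refine (Finset.card_le_card (t := {v, -v}) ?_).trans Finset.card_le_two
    intro w hw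
    simp only [Finset.mem_filter, Finset.mem_univ, true_and] at hv hw
    rw [← hv] at hw
    simpa using sq_eq_sq_iff_eq_or_eq_neg.1 hw

/-- The square roots modulo `q` of the elements `bn`, `n ∼ N`. -/
def rootSet (q : ℕ) [NeZero q] (b : ZMod q) (N : ℕ) : Finset (ZMod q) :=
  Finset.univ.filter fun v => (v ^ 2 * b⁻¹).val ∈ dyadic N

lemma mem_rootSet {b v : ZMod q} {N : ℕ} :
    v ∈ rootSet q b N ↔ N ≤ (v ^ 2 * b⁻¹).val ∧ (v ^ 2 * b⁻¹).val < 2 * N := by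
  simp [rootSet, dyadic]

/-- Summing over square roots of `bn`, `n ∼ N`, is summing over `rootSet`. -/
lemma sum_rootSet {b : ZMod q} (hb : b ≠ 0) {N : ℕ} (hNq : 2 * N ≤ q) {E : Type*} [AddCommMonoid E]
    (f : ℕ → ZMod q → E) :
    ∑ n ∈ dyadic N, ∑ v : ZMod q with v ^ 2 = b * n, f n v =
      ∑ v ∈ rootSet q b N, f (v ^ 2 * b⁻¹).val v := by
  rw [← Finset.sum_fiberwise_of_maps_to (s := rootSet q b N) (t := dyadic N)
    (g := fun v => (v ^ 2 * b⁻¹).val) (fun v hv => (Finset.mem_filter.1 hv).2)]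
  refine Finset.sum_congr rfl fun n hn => ?_
  have hnq : n < q := by
    simp only [dyadic, Finset.mem_Ico] at hn; omega
  have hset : (Finset.univ.filter fun v : ZMod q => v ^ 2 = b * n) =
      (rootSet q b N).filter fun v => (v ^ 2 * b⁻¹).val = n := by
    ext v
    simp only [rootSet, Finset.mem_filter, Finset.mem_univ, true_and]
    constructor
    · intro h
      have : (v ^ 2 * b⁻¹).val = n := by
        rw [h, mul_comm b, mul_assoc, mul_inv_cancel₀ hb, mul_one, ZMod.val_cast_of_lt hnq]
      exact ⟨this ▸ hn, this⟩
    · rintro ⟨-, h⟩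
      rw [← h, ZMod.natCast_zmod_val]
      field_simp
  rw [hset]
  exact Finset.sum_congr rfl fun v hv => by rw [(Finset.mem_filter.1 hv).2]

lemma sum_rootSet_le {b : ZMod q} (hb : b ≠ 0) {N : ℕ} (hNq : 2 * N ≤ q) (f : ℕ → ℝ)
    (hf : ∀ n, 0 ≤ f n) :
    ∑ v ∈ rootSet q b N, f (v ^ 2 * b⁻¹).val ≤ 2 * ∑ n ∈ dyadic N, f n := by
  rw [← sum_rootSet hb hNq (fun n _ => f n), Finset.mul_sum]
  refine Finset.sum_le_sum fun n _ => ?_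
  rw [Finset.sum_const, nsmul_eq_mul]
  have : ((Finset.univ.filter fun v : ZMod q => v ^ 2 = b * n).card : ℝ) ≤ 2 := by
    exact_mod_cast card_sqrt_le_two _
  exact mul_le_mul_of_nonneg_right this (hf n)

lemma card_rootSet_le {b : ZMod q} (hb : b ≠ 0) {N : ℕ} (hNq : 2 * N ≤ q) :
    ((rootSet q b N).card : ℝ) ≤ 2 * N := by
  have := sum_rootSet_le hb hNq (fun _ => 1) (fun _ => zero_le_one)
  have hcard : 2 * N - N = N := by omega
  simpa [dyadic, hcard] using this

/-- The number of representations of `t` as a difference of two elements of `rootSet`. -/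
def rootDiffCount (q : ℕ) [NeZero q] (b : ZMod q) (N : ℕ) (t : ZMod q) : ℕ :=
  ((rootSet q b N).filter fun v => v + t ∈ rootSet q b N).card

/-- With `n = v²/b` and `n' = (v + t)²/b`, take `x = n' - n` and `y = n' + n`. Here `x = (2vt +
t²)/b` is affine in `v` with nonzero slope, so `v` is recovered from `x`. -/
lemma rootDiffCount_le_card_parabolaSet (hq2 : q ≠ 2) {b t : ZMod q} (hb : b ≠ 0) (ht : t ≠ 0)
    (N : ℕ) : rootDiffCount q b N t ≤ (parabolaSet q (t ^ 2 * b⁻¹) N).card := by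
  have h2 := two_ne_zero_zmod hq2
  refine Finset.card_le_card_of_injOn
    (fun v => (((v + t) ^ 2 * b⁻¹).val : ℤ) - ((v ^ 2 * b⁻¹).val : ℤ)) ?_ ?_
  · intro v hv
    simp only [Finset.coe_filter, Set.mem_ofPred_eq, mem_rootSet] at hv
    obtain ⟨⟨h1, h2⟩, h3, h4⟩ := hv
    simp only [Finset.mem_coe]
    rw [mem_parabolaSet]
    refine ⟨by rw [abs_lt]; omega,
      (((v + t) ^ 2 * b⁻¹).val : ℤ) + ((v ^ 2 * b⁻¹).val : ℤ), by omega, by omega, ?_⟩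
    push_cast
    rw [ZMod.natCast_zmod_val, ZMod.natCast_zmod_val]
    ring
  · intro v _ w _ h
    have h' := congrArg (Int.cast : ℤ → ZMod q) h
    push_cast at h'
    rw [ZMod.natCast_zmod_val, ZMod.natCast_zmod_val, ZMod.natCast_zmod_val,
      ZMod.natCast_zmod_val] at h'
    have hbi : b⁻¹ ≠ 0 := inv_ne_zero hb
    have h3 : (2 * t * b⁻¹) * v = (2 * t * b⁻¹) * w := by linear_combination h'
    exact mul_left_cancel₀ (mul_ne_zero (mul_ne_zero h2 ht) hbi) h3

lemma sum_rootDiffCount_le {b : ZMod q} (hb : b ≠ 0) {N : ℕ} (hNq : 2 * N ≤ q) :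
    ∑ t, (rootDiffCount q b N t : ℝ) ≤ 4 * N ^ 2 := by
  have h1 : ∑ t, rootDiffCount q b N t = (rootSet q b N).card ^ 2 := by
    simp only [rootDiffCount, Finset.card_filter]
    rw [Finset.sum_comm, sq, ← smul_eq_mul, ← Finset.sum_const]
    refine Finset.sum_congr rfl fun v _ => ?_
    refine (Equiv.sum_comp (Equiv.addLeft v) (fun w => if w ∈ rootSet q b N then 1 else 0)).trans ?_
    simp
  have h2 := card_rootSet_le hb hNq
  calc ∑ t, (rootDiffCount q b N t : ℝ) = ((rootSet q b N).card : ℝ) ^ 2 := by exact_mod_cast h1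
    _ ≤ (2 * N) ^ 2 := by gcongr
    _ = _ := by ring

/-- The fourth moment of the number of representations as a difference of square roots. -/
lemma sum_rootDiffCount_pow_four_le (hq2 : q ≠ 2) {b : ZMod q} (hb : b ≠ 0) {N : ℕ} (hN : 0 < N)
    (hNq : 2 * N ≤ q) {D : ℝ} (hD1 : 1 ≤ D)
    (hD : ∀ n : ℕ, n ≠ 0 → n ≤ q ^ 2 → (n.divisors.card : ℝ) ≤ D) :
    ∑ t ∈ Finset.univ.erase (0 : ZMod q), (rootDiffCount q b N t : ℝ) ^ 4 ≤
      4 * N ^ 2 * (8 * D * (1 + 64 * N ^ 3 / q) * √(8 * D * (1 + 64 * N ^ 3 / q))) +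
        65536 * D ^ 2 * N ^ 3 * (1 + 2 * Real.log q) ^ 2 := by
  have h2 := two_ne_zero_zmod hq2
  have hqpos : 0 < q := (Fact.out : q.Prime).pos
  set A : ℝ := 8 * D * (1 + 64 * N ^ 3 / q) with hA
  have hA0 : 0 ≤ A := by positivity
  set P : Finset (ℤ × ℤ) := (Finset.Icc (-((N ^ 2 : ℕ) : ℤ)) (N ^ 2 : ℕ)).filter (· ≠ 0) ×ˢ
    (Finset.Icc (-((2 * N : ℕ) : ℤ)) (2 * N : ℕ)).filter (· ≠ 0) with hP
  set C : ℤ × ℤ → ℝ := fun p => 8192 * D ^ 2 * N ^ 3 / (|(p.1 : ℝ)| * |(p.2 : ℝ)|) with hC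
  have hC0 : ∀ p, 0 ≤ C p := fun p => by simp only [hC]; positivity
  -- In the sparse case one factor `r` is kept, so that the first moment of the counts can be used.
  -- In the other case `r⁴` is bounded by a single term of a nonnegative sum over all admissible
  -- pairs `(u, w)`, and the two bounds are added.
  have hpt : ∀ t ∈ Finset.univ.erase (0 : ZMod q), (rootDiffCount q b N t : ℝ) ^ 4 ≤
      rootDiffCount q b N t * (A * √A) +
        ∑ p ∈ P, if (p.2 : ZMod q) ≠ 0 ∧ (p.1 : ZMod q) = 2 * (t ^ 2 * b⁻¹) * p.2 then C p else 0 := by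
    intro t ht
    have ht0 : t ≠ 0 := (Finset.mem_erase.1 ht).1
    have hr : (rootDiffCount q b N t : ℝ) ≤ (parabolaSet q (t ^ 2 * b⁻¹) N).card := by
      exact_mod_cast rootDiffCount_le_card_parabolaSet hq2 hb ht0 N
    have hs : t ^ 2 * b⁻¹ ≠ 0 := mul_ne_zero (pow_ne_zero 2 ht0) (inv_ne_zero hb)
    set r : ℝ := (rootDiffCount q b N t : ℝ)
    have hr0 : 0 ≤ r := Nat.cast_nonneg _
    have hsum0 : 0 ≤ ∑ p ∈ P, if (p.2 : ZMod q) ≠ 0 ∧ (p.1 : ZMod q) = 2 * (t ^ 2 * b⁻¹) * p.2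
        then C p else 0 := Finset.sum_nonneg fun p _ => by split_ifs <;> [exact hC0 p; rfl]
    rcases card_parabolaSet_dichotomy hq2 hN hNq hs hD1 hD with h | ⟨u, w, hu, hw, hu', hw', huw, h⟩
    · have hrA : r ^ 2 ≤ A := le_trans (by gcongr) h
      have hrs : r ≤ √A := Real.le_sqrt_of_sq_le hrA
      have : r ^ 4 ≤ r * (A * √A) := by
        calc r ^ 4 = r * (r ^ 2 * r) := by ring
          _ ≤ _ := by gcongr
      linarith
    · have hw0 : w ≠ 0 := fun h => hw (by rw [h]; simp)
      have hmem : (u, w) ∈ P := by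
        rw [hP, Finset.mem_product, Finset.mem_filter, Finset.mem_filter, Finset.mem_Icc,
          Finset.mem_Icc]
        exact ⟨⟨abs_le.1 hu', hu⟩, abs_le.1 hw', hw0⟩
      have h1 : C (u, w) ≤ ∑ p ∈ P, if (p.2 : ZMod q) ≠ 0 ∧
          (p.1 : ZMod q) = 2 * (t ^ 2 * b⁻¹) * p.2 then C p else 0 := by
        refine le_trans ?_ (Finset.single_le_sum (fun p _ => ?_) hmem)
        · rw [if_pos ⟨hw, huw⟩]
        · split_ifs <;> [exact hC0 p; rfl]
      have h2 : r ^ 4 ≤ C (u, w) := le_trans (by gcongr) h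
      have : 0 ≤ r * (A * √A) := by positivity
      linarith
  refine (Finset.sum_le_sum hpt).trans ?_
  rw [Finset.sum_add_distrib]
  refine add_le_add ?_ ?_
  · rw [← Finset.sum_mul]
    refine mul_le_mul_of_nonneg_right ?_ (by positivity)
    refine le_trans ?_ (sum_rootDiffCount_le hb hNq)
    exact Finset.sum_le_sum_of_subset_of_nonneg (Finset.subset_univ _) fun _ _ _ => by positivity
  · rw [Finset.sum_comm]
    -- A pair `(u, w)` fixes `t² = ub/(2w)`, so it serves at most two values of `t`.
    have hin : ∀ p ∈ P, (∑ t ∈ Finset.univ.erase (0 : ZMod q),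
        if (p.2 : ZMod q) ≠ 0 ∧ (p.1 : ZMod q) = 2 * (t ^ 2 * b⁻¹) * p.2 then C p else 0) ≤
        2 * C p := by
      intro p _
      rw [← Finset.sum_filter, Finset.sum_const, nsmul_eq_mul]
      refine mul_le_mul_of_nonneg_right ?_ (hC0 p)
      have hsub : ((Finset.univ.erase (0 : ZMod q)).filter fun t => (p.2 : ZMod q) ≠ 0 ∧
          (p.1 : ZMod q) = 2 * (t ^ 2 * b⁻¹) * p.2) ⊆
          Finset.univ.filter fun t : ZMod q => t ^ 2 = p.1 * b * (2 * (p.2 : ZMod q))⁻¹ := by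
        intro t ht
        simp only [Finset.mem_filter, Finset.mem_univ, true_and] at ht ⊢
        obtain ⟨-, hw, h⟩ := ht
        rw [h]
        field_simp
      exact_mod_cast (Finset.card_le_card hsub).trans (card_sqrt_le_two _)
    refine (Finset.sum_le_sum hin).trans ?_
    rw [← Finset.mul_sum]
    have hfac : ∑ p ∈ P, C p = 8192 * D ^ 2 * N ^ 3 *
        ((∑ u ∈ (Finset.Icc (-((N ^ 2 : ℕ) : ℤ)) (N ^ 2 : ℕ)).filter (· ≠ 0), |(u : ℝ)|⁻¹) *
          ∑ w ∈ (Finset.Icc (-((2 * N : ℕ) : ℤ)) (2 * N : ℕ)).filter (· ≠ 0), |(w : ℝ)|⁻¹) := by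
      rw [Finset.sum_mul_sum, ← Finset.sum_product', Finset.mul_sum]
      refine Finset.sum_congr rfl fun p _ => ?_
      simp only [hC, div_eq_mul_inv, mul_inv]
    have hq1 : (1 : ℝ) ≤ q := by exact_mod_cast hqpos
    have hlog0 : 0 ≤ Real.log q := Real.log_nonneg hq1
    have hb1 : 1 + Real.log (N ^ 2 : ℕ) ≤ 1 + 2 * Real.log q := by
      push_cast
      rw [Real.log_pow]
      have : Real.log N ≤ Real.log q :=
        Real.log_le_log (by exact_mod_cast hN) (by exact_mod_cast (by omega : N ≤ q))
      push_cast; linarith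
    have hb2 : 1 + Real.log (2 * N : ℕ) ≤ 1 + 2 * Real.log q := by
      have : Real.log (2 * N : ℕ) ≤ Real.log q :=
        Real.log_le_log (by exact_mod_cast (by omega : 0 < 2 * N)) (by exact_mod_cast hNq)
      linarith
    have hs1 := sum_inv_abs_le (N ^ 2)
    have hs2 := sum_inv_abs_le (2 * N)
    rw [hfac]
    calc _ ≤ 2 * (8192 * D ^ 2 * N ^ 3 * ((2 * (1 + 2 * Real.log q)) * (2 * (1 + 2 * Real.log q)))) := by
          gcongr
          · exact hs1.trans (by gcongr)
          · exact hs2.trans (by gcongr)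
      _ = _ := by ring

end

/-! ### Linear and quadratic exponential sums. -/

section

variable {q : ℕ} [NeZero q]

lemma norm_stdAddChar (x : ZMod q) : ‖ZMod.stdAddChar x‖ = 1 := by
  rw [ZMod.stdAddChar_apply]; exact Circle.norm_coe _

lemma conj_stdAddChar (x : ZMod q) :
    (starRingEnd ℂ) (ZMod.stdAddChar x) = ZMod.stdAddChar (-x) := by
  rw [ZMod.stdAddChar_apply, ZMod.stdAddChar_apply, AddChar.map_neg_eq_inv, Circle.coe_inv_eq_conj]

lemma stdAddChar_ne_one {x : ZMod q} (hx : x ≠ 0) : (ZMod.stdAddChar x : ℂ) ≠ 1 := fun h =>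
  hx (ZMod.injective_stdAddChar (h.trans (AddChar.map_zero_eq_one _).symm))

/-- With `y = x.val / q`, `‖e(y) - 1‖ = 2|sin πy|` and `sin πy ≥ 2y(1 - y)`; partial fractions of
`1/(y(1 - y))` then leave two terms whose sums over `x` are harmonic. -/
lemma two_div_norm_stdAddChar_sub_one_le {x : ZMod q} (hx : x ≠ 0) :
    2 / ‖(ZMod.stdAddChar x : ℂ) - 1‖ ≤ q / 2 * ((x.val : ℝ)⁻¹ + ((-x).val : ℝ)⁻¹) := by
  have hq : (0 : ℝ) < q := by exact_mod_cast NeZero.pos q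
  have hj0 : 0 < x.val := Nat.pos_of_ne_zero (by rwa [Ne, ZMod.val_eq_zero])
  have hjq : x.val < q := ZMod.val_lt x
  have hneg : ((-x).val : ℝ) = q - x.val := by
    rw [ZMod.neg_val, if_neg hx, Nat.cast_sub hjq.le]
  set j : ℝ := (x.val : ℝ) with hj
  have hj0' : 0 < j := by rw [hj]; exact_mod_cast hj0
  have hjq' : j < q := by rw [hj]; exact_mod_cast hjq
  have hnorm : ‖(ZMod.stdAddChar x : ℂ) - 1‖ = 2 * |Real.sin (Real.pi * (j / q))| := by
    have h1 : (ZMod.stdAddChar x : ℂ) = Complex.exp (Complex.I * (2 * (Real.pi * (j / q)) : ℝ)) := by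
      conv_lhs => rw [← ZMod.natCast_zmod_val x]
      have := ZMod.stdAddChar_coe (N := q) (x.val : ℤ)
      rw [Int.cast_natCast] at this
      rw [this]
      congr 1
      rw [hj]
      push_cast
      ring
    rw [h1, Complex.norm_exp_I_mul_ofReal_sub_one, Real.norm_eq_abs, abs_mul]
    norm_num
  have hsin : 2 * (j / q) * (1 - j / q) ≤ Real.sin (Real.pi * (j / q)) := by
    set y := j / q with hy
    have hy0 : 0 < y := by positivity
    have hy1 : y < 1 := by rw [hy, div_lt_one hq]; exact hjq'
    rcases le_total y (1 / 2) with h | h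
    · have := Real.mul_le_sin (x := Real.pi * y) (by positivity) (by nlinarith [Real.pi_pos])
      have e : 2 / Real.pi * (Real.pi * y) = 2 * y := by field_simp
      rw [e] at this
      nlinarith
    · have := Real.mul_le_sin (x := Real.pi - Real.pi * y) (by nlinarith [Real.pi_pos])
        (by nlinarith [Real.pi_pos])
      have e : 2 / Real.pi * (Real.pi - Real.pi * y) = 2 * (1 - y) := by field_simp
      rw [e, Real.sin_pi_sub] at this
      nlinarith
  have hpos : 0 < 2 * (j / q) * (1 - j / q) := by
    have : 0 < 1 - j / q := by rw [sub_pos, div_lt_one hq]; exact hjq'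
    positivity
  rw [hnorm, hneg]
  calc 2 / (2 * |Real.sin (Real.pi * (j / q))|) ≤ 2 / (2 * (2 * (j / q) * (1 - j / q))) := by
        gcongr
        exact hsin.trans (le_abs_self _)
    _ = _ := by
      have : (q : ℝ) - j ≠ 0 := by linarith
      field_simp
      ring

lemma sum_two_div_norm_stdAddChar_sub_one_le :
    ∑ x ∈ Finset.univ.erase (0 : ZMod q), 2 / ‖(ZMod.stdAddChar x : ℂ) - 1‖ ≤
      q * (1 + Real.log q) := by
  have hval : ∑ x ∈ Finset.univ.erase (0 : ZMod q), (x.val : ℝ)⁻¹ ≤ 1 + Real.log q := by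
    have hharm : ∑ n ∈ Finset.Icc 1 q, ((n : ℝ))⁻¹ ≤ 1 + Real.log q := by
      have := harmonic_le_one_add_log q
      rw [harmonic_eq_sum_Icc] at this
      push_cast at this
      exact this
    rw [← Finset.sum_image (f := fun n : ℕ => (n : ℝ)⁻¹) (g := ZMod.val)
      (fun _ _ _ _ h => ZMod.val_injective q h)]
    refine le_trans (Finset.sum_le_sum_of_subset_of_nonneg ?_ fun _ _ _ => by positivity) hharm
    intro n hn
    obtain ⟨x, hx, rfl⟩ := Finset.mem_image.1 hn
    rw [Finset.mem_Icc]
    exact ⟨Nat.pos_of_ne_zero (by rw [Ne, ZMod.val_eq_zero]; exact (Finset.mem_erase.1 hx).1),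
      (ZMod.val_lt x).le⟩
  have hneg : ∑ x ∈ Finset.univ.erase (0 : ZMod q), ((-x).val : ℝ)⁻¹ =
      ∑ x ∈ Finset.univ.erase (0 : ZMod q), (x.val : ℝ)⁻¹ :=
    Finset.sum_bij' (fun x _ => -x) (fun x _ => -x) (by simp) (by simp) (by simp) (by simp) (by simp)
  calc _ ≤ ∑ x ∈ Finset.univ.erase (0 : ZMod q),
        (q : ℝ) / 2 * ((x.val : ℝ)⁻¹ + ((-x).val : ℝ)⁻¹) :=
        Finset.sum_le_sum fun x hx => two_div_norm_stdAddChar_sub_one_le (Finset.mem_erase.1 hx).1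
    _ = q * ∑ x ∈ Finset.univ.erase (0 : ZMod q), (x.val : ℝ)⁻¹ := by
      rw [← Finset.mul_sum, Finset.sum_add_distrib, hneg]; ring
    _ ≤ _ := by gcongr

/-- Linear exponential sums over intervals. -/
lemma norm_sum_Ico_stdAddChar_le {θ : ZMod q} (hθ : θ ≠ 0) (a b : ℤ) :
    ‖∑ x ∈ Finset.Ico a b, (ZMod.stdAddChar (θ * (x : ZMod q)) : ℂ)‖ ≤
      2 / ‖(ZMod.stdAddChar θ : ℂ) - 1‖ := by
  have hpos : 0 < ‖(ZMod.stdAddChar θ : ℂ) - 1‖ := norm_pos_iff.2 (sub_ne_zero.2 (stdAddChar_ne_one hθ))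
  rcases le_total b a with hab | hab
  · rw [Finset.Ico_eq_empty (not_lt.2 hab), Finset.sum_empty, norm_zero]; positivity
  have htel : (∑ x ∈ Finset.Ico a b, (ZMod.stdAddChar (θ * (x : ZMod q)) : ℂ)) *
      ((ZMod.stdAddChar θ : ℂ) - 1) =
      ZMod.stdAddChar (θ * (b : ZMod q)) - ZMod.stdAddChar (θ * (a : ZMod q)) := by
    induction b, hab using Int.leInduction with
    | base => simp
    | succ b hab ih =>
      rw [← Finset.insert_Ico_right_eq_Ico_add_one hab, Finset.sum_insert (by simp), add_mul, ih]
      push_cast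
      rw [mul_add, mul_one, AddChar.map_add_eq_mul]
      ring
  rw [le_div_iff₀ hpos, ← norm_mul, htel]
  refine (norm_sub_le _ _).trans ?_
  rw [norm_stdAddChar, norm_stdAddChar]
  norm_num

/-- The quadratic exponential sum `∑_{|x| < N} e_q(κ x²)`. -/
noncomputable def quadraticSum (q : ℕ) [NeZero q] (N : ℕ) (κ : ZMod q) : ℂ :=
  ∑ x ∈ Finset.Ioo (-(N : ℤ)) N, ZMod.stdAddChar (κ * (x : ZMod q) ^ 2)

lemma norm_quadraticSum_le (N : ℕ) (κ : ZMod q) : ‖quadraticSum q N κ‖ ≤ 2 * N := by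
  refine (norm_sum_le _ _).trans ?_
  simp only [norm_stdAddChar, Finset.sum_const, Int.card_Ioo, nsmul_eq_mul, mul_one]
  have : ((N : ℤ) - -(N : ℤ) - 1).toNat ≤ 2 * N := by omega
  exact_mod_cast this

/-- Weyl differencing. -/
lemma sq_norm_quadraticSum_le (N : ℕ) (κ : ZMod q) :
    ‖quadraticSum q N κ‖ ^ 2 ≤ ∑ d ∈ Finset.Ioo (-(2 * N : ℤ)) (2 * N),
      ‖∑ x ∈ Finset.Ico (max (-(N : ℤ)) (-N - d) + 1) (min (N : ℤ) (N - d)),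
        (ZMod.stdAddChar (2 * κ * (d : ZMod q) * (x : ZMod q)) : ℂ)‖ := by
  set J := Finset.Ioo (-(N : ℤ)) N with hJ
  have h1 : ((‖quadraticSum q N κ‖ ^ 2 : ℝ) : ℂ) =
      ∑ d ∈ Finset.Ioo (-(2 * N : ℤ)) (2 * N), (ZMod.stdAddChar (κ * (d : ZMod q) ^ 2) : ℂ) *
        ∑ x ∈ Finset.Ico (max (-(N : ℤ)) (-N - d) + 1) (min (N : ℤ) (N - d)),
          (ZMod.stdAddChar (2 * κ * (d : ZMod q) * (x : ZMod q)) : ℂ) := by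
    -- Substituting `x' = x + d` turns `κ(x'² - x²)` into `κd² + 2κdx`, which is linear in `x`.
    have hinner : ∀ x ∈ J, (∑ x' ∈ J, (ZMod.stdAddChar (κ * (x' : ZMod q) ^ 2) : ℂ) *
        ZMod.stdAddChar (-(κ * (x : ZMod q) ^ 2))) =
        ∑ d ∈ Finset.Ioo (-(2 * N : ℤ)) (2 * N), if x + d ∈ J then
          (ZMod.stdAddChar (κ * (d : ZMod q) ^ 2) : ℂ) *
            ZMod.stdAddChar (2 * κ * (d : ZMod q) * (x : ZMod q)) else 0 := by
      intro x hx
      rw [← Finset.sum_filter]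
      refine Finset.sum_bij' (fun x' _ => x' - x) (fun d _ => x + d) ?_ ?_ ?_ ?_ ?_
      · intro x' hx'
        simp only [hJ, Finset.mem_Ioo, Finset.mem_filter] at hx hx' ⊢
        omega
      · intro d hd
        exact (Finset.mem_filter.1 hd).2
      · intro x' _; ring
      · intro d _; ring
      · intro x' _
        rw [← AddChar.map_add_eq_mul, ← AddChar.map_add_eq_mul]
        congr 1
        push_cast
        ring
    rw [Complex.ofReal_pow, ← Complex.mul_conj', quadraticSum, map_sum, Finset.sum_mul_sum,
      Finset.sum_comm]
    simp only [conj_stdAddChar]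
    rw [Finset.sum_congr rfl hinner, Finset.sum_comm]
    refine Finset.sum_congr rfl fun d _ => ?_
    rw [← Finset.sum_filter, ← Finset.mul_sum]
    congr 2
    ext x
    simp only [hJ, Finset.mem_filter, Finset.mem_Ioo, Finset.mem_Ico]
    omega
  have h2 : ‖quadraticSum q N κ‖ ^ 2 = ‖((‖quadraticSum q N κ‖ ^ 2 : ℝ) : ℂ)‖ := by
    rw [Complex.norm_real, Real.norm_of_nonneg (by positivity)]
  rw [h2, h1]
  refine (norm_sum_le _ _).trans (Finset.sum_le_sum fun d _ => ?_)
  rw [norm_mul, norm_stdAddChar, one_mul]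

end

/-! ### The pointwise bound for points on a parabola. -/

section

variable {q : ℕ} [Fact q.Prime]

lemma intCast_zmod_ne_zero {z : ℤ} (hz : z ≠ 0) (hzq : |z| < q) : (z : ZMod q) ≠ 0 := by
  rw [Ne, ZMod.intCast_zmod_eq_zero_iff_dvd]
  exact fun h => hz (Int.eq_zero_of_abs_lt_dvd h hzq)

/-- After Weyl differencing, `d = 0` costs `2N` for each `k`, and the other frequencies are `2λkd`
with `0 < |kd| ≤ 2NK`. Two such products differ by at most `4NK < q`, so a frequency determines the
integer `kd`, whose divisors leave at most `2D` pairs `(k, d)`. The geometric sums are therefore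
bounded by `2D` times a sum over all nonzero residues. -/
lemma sum_sq_norm_quadraticSum_le (hq2 : q ≠ 2) {N K : ℕ} (hN : 0 < N) (hK : 0 < K)
    (hNK : 6 * N * K ≤ q) {lam : ZMod q} (hlam : lam ≠ 0) {D : ℝ} (hD1 : 1 ≤ D)
    (hD : ∀ n : ℕ, n ≠ 0 → n ≤ q ^ 2 → (n.divisors.card : ℝ) ≤ D) :
    ∑ k ∈ (Finset.Ioo (-(K : ℤ)) K).filter (· ≠ 0), ‖quadraticSum q N (k * lam)‖ ^ 2 ≤
      4 * N * K + 2 * D * (q * (1 + Real.log q)) := by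
  classical
  have h2 := two_ne_zero_zmod hq2
  have hqZ : (6 * (N : ℤ) * K) ≤ q := by exact_mod_cast hNK
  have hNZ : (1 : ℤ) ≤ N := by exact_mod_cast hN
  have hKZ : (1 : ℤ) ≤ K := by exact_mod_cast hK
  set g : ZMod q → ℝ := fun x => 2 / ‖(ZMod.stdAddChar x : ℂ) - 1‖ with hg
  have hg0 : ∀ x, 0 ≤ g x := fun x => by simp only [hg]; positivity
  set Ks := (Finset.Ioo (-(K : ℤ)) K).filter (· ≠ 0) with hKs
  set Ds := (Finset.Ioo (-(2 * N : ℤ)) (2 * N)).filter (· ≠ 0) with hDs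
  have hKmem : ∀ k ∈ Ks, k ≠ 0 ∧ |k| < K := by
    intro k hk
    simp only [hKs, Finset.mem_filter, Finset.mem_Ioo] at hk
    exact ⟨hk.2, abs_lt.2 hk.1⟩
  have hDmem : ∀ d ∈ Ds, d ≠ 0 ∧ |d| < 2 * N := by
    intro d hd
    simp only [hDs, Finset.mem_filter, Finset.mem_Ioo] at hd
    exact ⟨hd.2, abs_lt.2 hd.1⟩
  have hprod : ∀ p ∈ Ks ×ˢ Ds, p.1 * p.2 ≠ 0 ∧ |p.1 * p.2| ≤ 2 * N * K := by
    intro p hp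
    obtain ⟨h1, h2⟩ := Finset.mem_product.1 hp
    refine ⟨mul_ne_zero (hKmem _ h1).1 (hDmem _ h2).1, ?_⟩
    rw [abs_mul]
    calc |p.1| * |p.2| ≤ K * (2 * N) := by
          gcongr
          · exact (hKmem _ h1).2.le
          · exact (hDmem _ h2).2.le
      _ = _ := by ring
  have hNK1 : (1 : ℤ) ≤ N * K := by nlinarith
  have hθ : ∀ p ∈ Ks ×ˢ Ds, 2 * (p.1 * lam) * (p.2 : ZMod q) ∈ Finset.univ.erase (0 : ZMod q) := by
    intro p hp
    obtain ⟨h3, h4⟩ := hprod p hp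
    have h5 := intCast_zmod_ne_zero (q := q) h3 (by nlinarith)
    rw [Finset.mem_erase]
    refine ⟨?_, Finset.mem_univ _⟩
    push_cast at h5
    have h6 : 2 * (p.1 * lam) * (p.2 : ZMod q) = 2 * lam * (p.1 * p.2) := by ring
    rw [h6]
    exact mul_ne_zero (mul_ne_zero h2 hlam) h5
  have hpt : ∀ k ∈ Ks, ‖quadraticSum q N (k * lam)‖ ^ 2 ≤
      2 * N + ∑ d ∈ Ds, g (2 * (k * lam) * (d : ZMod q)) := by
    intro k hk
    refine (sq_norm_quadraticSum_le N _).trans ?_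
    rw [← Finset.add_sum_erase _ _ (show (0 : ℤ) ∈ Finset.Ioo (-(2 * N : ℤ)) (2 * N) by
      rw [Finset.mem_Ioo]; constructor <;> linarith)]
    have herase : (Finset.Ioo (-(2 * N : ℤ)) (2 * N)).erase 0 = Ds := by
      ext d; simp [hDs, and_comm]
    rw [herase]
    refine add_le_add ?_ (Finset.sum_le_sum fun d hd => ?_)
    · refine (norm_sum_le _ _).trans ?_
      simp only [norm_stdAddChar, Finset.sum_const, Int.card_Ico, nsmul_eq_mul, mul_one]
      have : (min (N : ℤ) (N - 0) - (max (-(N : ℤ)) (-N - 0) + 1)).toNat ≤ 2 * N := by omega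
      exact_mod_cast this
    · have := hθ (k, d) (Finset.mem_product.2 ⟨hk, hd⟩)
      exact norm_sum_Ico_stdAddChar_le (Finset.mem_erase.1 this).1 _ _
  refine (Finset.sum_le_sum hpt).trans ?_
  rw [Finset.sum_add_distrib]
  refine add_le_add ?_ ?_
  · rw [Finset.sum_const, nsmul_eq_mul]
    have hc : Ks.card ≤ 2 * K := by
      refine (Finset.card_filter_le _ _).trans ?_
      rw [Int.card_Ioo]; omega
    have hc' : (Ks.card : ℝ) ≤ 2 * K := by exact_mod_cast hc
    calc (Ks.card : ℝ) * (2 * N) ≤ 2 * K * (2 * N) := by gcongr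
      _ = _ := by ring
  · rw [← Finset.sum_product' (f := fun k d : ℤ => g (2 * (k * lam) * (d : ZMod q))),
      ← Finset.sum_fiberwise_of_maps_to hθ]
    have hfib : ∀ θ ∈ Finset.univ.erase (0 : ZMod q),
        (∑ p ∈ (Ks ×ˢ Ds).filter (fun p => 2 * (p.1 * lam) * (p.2 : ZMod q) = θ),
          g (2 * (p.1 * lam) * (p.2 : ZMod q))) ≤ 2 * D * g θ := by
      intro θ _
      rw [Finset.sum_congr rfl (g := fun _ => g θ) fun p hp => by rw [(Finset.mem_filter.1 hp).2],
        Finset.sum_const, nsmul_eq_mul]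
      refine mul_le_mul_of_nonneg_right ?_ (hg0 θ)
      set F := (Ks ×ˢ Ds).filter (fun p => 2 * (p.1 * lam) * (p.2 : ZMod q) = θ) with hF
      rcases Finset.eq_empty_or_nonempty F with h0 | ⟨p₀, hp₀⟩
      · rw [h0]; simp; linarith
      have hp₀' := Finset.mem_filter.1 hp₀
      obtain ⟨hj0, hjle⟩ := hprod p₀ hp₀'.1
      have heq : ∀ p ∈ F, p.1 * p.2 = p₀.1 * p₀.2 := by
        intro p hp
        have hp' := Finset.mem_filter.1 hp
        obtain ⟨-, hle⟩ := hprod p hp'.1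
        by_contra hne
        have h3 := intCast_zmod_ne_zero (q := q) (sub_ne_zero.2 hne) (by
          refine lt_of_le_of_lt (abs_sub _ _) ?_
          nlinarith)
        apply h3
        have h4 : (2 * lam) * ((p.1 : ZMod q) * p.2) = (2 * lam) * (p₀.1 * p₀.2) := by
          have := hp'.2.trans hp₀'.2.symm
          linear_combination this
        have h5 := mul_left_cancel₀ (mul_ne_zero h2 hlam) h4
        push_cast
        rw [h5, sub_self]
      have hinj : Set.InjOn Prod.fst (F : Set (ℤ × ℤ)) := by
        intro p hp p' hp' h
        have e := (heq p hp).trans (heq p' hp').symm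
        rw [h] at e
        have hne : p'.1 ≠ 0 :=
          (hKmem _ (Finset.mem_product.1 (Finset.mem_filter.1 hp').1).1).1
        exact Prod.ext h (mul_left_cancel₀ hne e)
      have h6 := card_le_two_mul_card_divisors (S := F.image Prod.fst) hj0 (by
        intro k hk
        obtain ⟨p, hp, rfl⟩ := Finset.mem_image.1 hk
        exact ⟨p.2, (heq p hp).symm⟩)
      rw [Finset.card_image_of_injOn hinj] at h6
      have h7 : ((p₀.1 * p₀.2).natAbs.divisors.card : ℝ) ≤ D := by
        refine hD _ (Int.natAbs_ne_zero.2 hj0) ?_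
        have h8 : (p₀.1 * p₀.2).natAbs ≤ 2 * N * K := by
          rw [Int.abs_eq_natAbs] at hjle
          exact_mod_cast hjle
        calc _ ≤ 2 * N * K := h8
          _ ≤ 6 * N * K := by gcongr; norm_num
          _ ≤ q := hNK
          _ ≤ q ^ 2 := Nat.le_self_pow (by norm_num) q
      calc (F.card : ℝ) ≤ 2 * ((p₀.1 * p₀.2).natAbs.divisors.card : ℝ) := by exact_mod_cast h6
        _ ≤ _ := by gcongr
    refine (Finset.sum_le_sum hfib).trans ?_
    rw [← Finset.mul_sum]
    have := sum_two_div_norm_stdAddChar_sub_one_le (q := q)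
    gcongr

lemma half_le_re_stdAddChar {z : ℤ} (hz : 6 * |z| ≤ q) :
    (1 / 2 : ℝ) ≤ (ZMod.stdAddChar (z : ZMod q) : ℂ).re := by
  have hq : (0 : ℝ) < q := by exact_mod_cast (Fact.out : q.Prime).pos
  have h1 : (ZMod.stdAddChar (z : ZMod q) : ℂ) =
      Complex.exp ((2 * Real.pi * z / q : ℝ) * Complex.I) := by
    rw [ZMod.stdAddChar_coe]; congr 1; push_cast; ring
  rw [h1, Complex.exp_ofReal_mul_I_re, ← Real.cos_abs, ← Real.cos_pi_div_three]
  refine Real.cos_le_cos_of_nonneg_of_le_pi (abs_nonneg _) (by linarith [Real.pi_pos]) ?_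
  have hzR : 6 * |(z : ℝ)| ≤ q := by exact_mod_cast hz
  rw [abs_div, abs_mul, abs_of_pos hq, abs_of_pos (by positivity : 0 < 2 * Real.pi),
    div_le_div_iff₀ hq (by norm_num)]
  nlinarith [Real.pi_pos]

/-- Counting points on a parabola in terms of quadratic exponential sums. -/
lemma card_parabolaSet_mul_le (hq2 : q ≠ 2) {N K : ℕ} (hK : 0 < K)
    (hNK : 6 * N * K ≤ q) {s : ZMod q} (hs : s ≠ 0) :
    ((parabolaSet q s N).card : ℝ) * K ≤
      4 * ∑ k ∈ Finset.Ioo (-(K : ℤ)) K, ‖quadraticSum q N (k * (2 * s)⁻¹)‖ := by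
  have h2 := two_ne_zero_zmod hq2
  have h2s : 2 * s ≠ 0 := mul_ne_zero h2 hs
  have hKR : (0 : ℝ) < K := by exact_mod_cast hK
  set lam := (2 * s)⁻¹ with hlam
  -- On the parabola `lam * x² + c` equals `y - 3N`, which has absolute value at most `N`. As `6NK ≤
  -- q`, the phases `k(y - 3N)/q` with `k < K` are at most `1/6` in size, so nothing cancels in `F
  -- x`.
  set c : ZMod q := lam * s ^ 2 - 3 * N with hc
  set F : ℤ → ℂ := fun x => ∑ k ∈ Finset.range K, ZMod.stdAddChar ((k : ZMod q) * (lam * (x : ZMod q) ^ 2 + c))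
    with hF
  have hlow : ∀ x ∈ parabolaSet q s N, (K : ℝ) ^ 2 / 4 ≤ ‖F x‖ ^ 2 := by
    intro x hx
    obtain ⟨-, y, hy1, hy2, hxy⟩ := mem_parabolaSet.1 hx
    have harg : lam * (x : ZMod q) ^ 2 + c = ((y - 3 * N : ℤ) : ZMod q) := by
      rw [hxy, hc, hlam]; push_cast; field_simp; ring
    have hre : (K : ℝ) / 2 ≤ ‖F x‖ := by
      refine le_trans ?_ (Complex.re_le_norm _)
      simp only [hF, harg, Complex.re_sum]
      calc (K : ℝ) / 2 = ∑ k ∈ Finset.range K, (1 / 2 : ℝ) := by simp; ring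
        _ ≤ _ := Finset.sum_le_sum fun k hk => by
          have hk' : k < K := Finset.mem_range.1 hk
          have := half_le_re_stdAddChar (q := q) (z := (k : ℤ) * (y - 3 * N)) (by
            rw [abs_mul]
            have e1 : |(k : ℤ)| ≤ K := by rw [Nat.abs_cast]; exact_mod_cast hk'.le
            have e2 : |y - 3 * (N : ℤ)| ≤ N := by rw [abs_le]; constructor <;> linarith
            calc 6 * (|(k : ℤ)| * |y - 3 * (N : ℤ)|) ≤ 6 * (K * N) := by gcongr
              _ = ((6 * N * K : ℕ) : ℤ) := by push_cast; ring
              _ ≤ q := by exact_mod_cast hNK)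
          push_cast at this ⊢
          exact this
    calc (K : ℝ) ^ 2 / 4 = (K / 2) ^ 2 := by ring
      _ ≤ _ := by gcongr
  have hsq : ∀ x : ℤ, ((‖F x‖ ^ 2 : ℝ) : ℂ) = ∑ k ∈ Finset.range K, ∑ l ∈ Finset.range K,
      ZMod.stdAddChar ((((k : ℤ) - l : ℤ) : ZMod q) * c) *
        ZMod.stdAddChar ((((k : ℤ) - l : ℤ) : ZMod q) * lam * (x : ZMod q) ^ 2) := by
    intro x
    rw [Complex.ofReal_pow, ← Complex.mul_conj', hF]
    simp only [map_sum, conj_stdAddChar]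
    rw [Finset.sum_mul_sum]
    refine Finset.sum_congr rfl fun k _ => Finset.sum_congr rfl fun l _ => ?_
    rw [← AddChar.map_add_eq_mul, ← AddChar.map_add_eq_mul]
    congr 1; push_cast; ring
  -- Positivity allows the sum over the parabola to be extended to all `|x| < N`; opening the square
  -- then gives quadratic sums at the differences `k - l`.
  have hup : ∑ x ∈ Finset.Ioo (-(N : ℤ)) N, ‖F x‖ ^ 2 ≤
      ∑ k ∈ Finset.range K, ∑ l ∈ Finset.range K,
        ‖quadraticSum q N ((((k : ℤ) - l : ℤ) : ZMod q) * lam)‖ := by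
    have h1 : ((∑ x ∈ Finset.Ioo (-(N : ℤ)) N, ‖F x‖ ^ 2 : ℝ) : ℂ) =
        ∑ k ∈ Finset.range K, ∑ l ∈ Finset.range K,
          ZMod.stdAddChar ((((k : ℤ) - l : ℤ) : ZMod q) * c) *
            quadraticSum q N ((((k : ℤ) - l : ℤ) : ZMod q) * lam) := by
      rw [Complex.ofReal_sum, Finset.sum_congr rfl fun x _ => hsq x, Finset.sum_comm]
      refine Finset.sum_congr rfl fun k _ => ?_
      rw [Finset.sum_comm]
      refine Finset.sum_congr rfl fun l _ => ?_
      rw [quadraticSum, Finset.mul_sum]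
    have h3 : ∑ x ∈ Finset.Ioo (-(N : ℤ)) N, ‖F x‖ ^ 2 =
        ‖((∑ x ∈ Finset.Ioo (-(N : ℤ)) N, ‖F x‖ ^ 2 : ℝ) : ℂ)‖ := by
      rw [Complex.norm_real, Real.norm_of_nonneg (by positivity)]
    rw [h3, h1]
    refine (norm_sum_le _ _).trans (Finset.sum_le_sum fun k _ => ?_)
    refine (norm_sum_le _ _).trans (Finset.sum_le_sum fun l _ => ?_)
    rw [norm_mul, norm_stdAddChar, one_mul]
  have hrow : ∀ k ∈ Finset.range K, ∑ l ∈ Finset.range K,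
      ‖quadraticSum q N ((((k : ℤ) - l : ℤ) : ZMod q) * lam)‖ ≤
      ∑ k ∈ Finset.Ioo (-(K : ℤ)) K, ‖quadraticSum q N (k * lam)‖ := by
    intro k hk
    rw [← Finset.sum_image (s := Finset.range K) (g := fun l : ℕ => (k : ℤ) - l)
      (f := fun z : ℤ => ‖quadraticSum q N ((z : ZMod q) * lam)‖)
      (fun a _ b _ h => by simpa using h)]
    refine Finset.sum_le_sum_of_subset_of_nonneg ?_ fun _ _ _ => norm_nonneg _
    intro z hz
    obtain ⟨l, hl, rfl⟩ := Finset.mem_image.1 hz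
    rw [Finset.mem_range] at hk hl
    rw [Finset.mem_Ioo]; omega
  have hmain : ((parabolaSet q s N).card : ℝ) * ((K : ℝ) ^ 2 / 4) ≤
      K * ∑ k ∈ Finset.Ioo (-(K : ℤ)) K, ‖quadraticSum q N (k * lam)‖ := by
    calc _ = ∑ x ∈ parabolaSet q s N, (K : ℝ) ^ 2 / 4 := by rw [Finset.sum_const, nsmul_eq_mul]
      _ ≤ ∑ x ∈ parabolaSet q s N, ‖F x‖ ^ 2 := Finset.sum_le_sum hlow
      _ ≤ ∑ x ∈ Finset.Ioo (-(N : ℤ)) N, ‖F x‖ ^ 2 :=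
        Finset.sum_le_sum_of_subset_of_nonneg (Finset.filter_subset _ _) fun _ _ _ => by positivity
      _ ≤ _ := hup
      _ ≤ _ := Finset.sum_le_sum hrow
      _ = _ := by rw [Finset.sum_const, nsmul_eq_mul, Finset.card_range]
  nlinarith

/-- Few points of a box lie on a parabola modulo `q`. -/
lemma card_parabolaSet_le (hq2 : q ≠ 2) {N : ℕ} (hN : 0 < N) {s : ZMod q} (hs : s ≠ 0)
    {D : ℝ} (hD1 : 1 ≤ D) (hD : ∀ n : ℕ, n ≠ 0 → n ≤ q ^ 2 → (n.divisors.card : ℝ) ≤ D) :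
    ((parabolaSet q s N).card : ℝ) ≤ 96 * N ^ 2 / q + 4 * √(72 * D * N * (1 + Real.log q)) := by
  have h2 := two_ne_zero_zmod hq2
  have hqN : 0 < q := (Fact.out : q.Prime).pos
  have hqR : (0 : ℝ) < q := by exact_mod_cast hqN
  have hNR : (0 : ℝ) < N := by exact_mod_cast hN
  have hlog : 0 ≤ Real.log q := Real.log_nonneg (by exact_mod_cast hqN)
  -- For `q < 6N` the trivial bound `2N` is already below `96N²/q`; otherwise `K ≥ 1` below.
  rcases lt_or_ge q (6 * N) with hsm | hlg
  · have hc : (parabolaSet q s N).card ≤ 2 * N := by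
      refine (Finset.card_filter_le _ _).trans ?_
      rw [Int.card_Ioo]; omega
    have hc' : ((parabolaSet q s N).card : ℝ) ≤ 2 * N := by exact_mod_cast hc
    have hsm' : (q : ℝ) ≤ 6 * N := by exact_mod_cast hsm.le
    have h3 : 2 * (N : ℝ) ≤ 96 * N ^ 2 / q := by
      rw [le_div_iff₀ hqR]; nlinarith
    have := Real.sqrt_nonneg (72 * D * N * (1 + Real.log q))
    linarith
  set K : ℕ := q / (6 * N) with hKdef
  have hK : 0 < K := Nat.div_pos hlg (by omega)
  have hKR : (0 : ℝ) < K := by exact_mod_cast hK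
  have hNK : 6 * N * K ≤ q := Nat.mul_div_le q (6 * N)
  have hK2 : (q : ℝ) ≤ 12 * N * K := by
    have h3 : q < 6 * N * (K + 1) := Nat.lt_mul_div_succ q (by omega)
    have h4 : q ≤ 12 * N * K := by nlinarith
    exact_mod_cast h4
  have hmain := card_parabolaSet_mul_le hq2 hK hNK hs
  have hms := sum_sq_norm_quadraticSum_le hq2 hN hK hNK (inv_ne_zero (mul_ne_zero h2 hs)) hD1 hD
  set S : ℤ → ℝ := fun k => ‖quadraticSum q N (k * (2 * s)⁻¹)‖ with hS
  have hsplit : ∑ k ∈ Finset.Ioo (-(K : ℤ)) K, S k =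
      S 0 + ∑ k ∈ (Finset.Ioo (-(K : ℤ)) K).filter (· ≠ 0), S k := by
    rw [← Finset.add_sum_erase _ _ (show (0 : ℤ) ∈ Finset.Ioo (-(K : ℤ)) K by
      rw [Finset.mem_Ioo]; omega)]
    congr 2
    ext d; simp [and_comm]
  have hS0 : S 0 ≤ 2 * N := norm_quadraticSum_le N _
  have hcs : ∑ k ∈ (Finset.Ioo (-(K : ℤ)) K).filter (· ≠ 0), S k ≤
      √(6 * K * D * q * (1 + Real.log q)) := by
    apply Real.le_sqrt_of_sq_le
    have hc : ((Finset.Ioo (-(K : ℤ)) K).filter (· ≠ 0)).card ≤ 2 * K := by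
      refine (Finset.card_filter_le _ _).trans ?_
      rw [Int.card_Ioo]; omega
    have hc' : (((Finset.Ioo (-(K : ℤ)) K).filter (· ≠ 0)).card : ℝ) ≤ 2 * K := by exact_mod_cast hc
    -- The diagonal contribution `4NK` is smaller than the off-diagonal one because `6NK ≤ q`.
    have h4 : 4 * (N : ℝ) * K ≤ D * (q * (1 + Real.log q)) := by
      have e1 : 6 * (N : ℝ) * K ≤ q := by exact_mod_cast hNK
      have e2 : (q : ℝ) * 1 ≤ q * (1 + Real.log q) := by gcongr; linarith
      have e3 : 1 * (q * (1 + Real.log q)) ≤ D * (q * (1 + Real.log q)) := by gcongr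
      have e4 : 0 ≤ (N : ℝ) * K := by positivity
      linarith
    calc _ ≤ _ := sq_sum_le_card_mul_sum_sq
      _ ≤ 2 * K * (4 * N * K + 2 * D * (q * (1 + Real.log q))) := by gcongr
      _ ≤ 2 * K * (D * (q * (1 + Real.log q)) + 2 * D * (q * (1 + Real.log q))) := by gcongr
      _ = _ := by ring
  have hI : ((parabolaSet q s N).card : ℝ) ≤
      4 * (2 * N + √(6 * K * D * q * (1 + Real.log q))) / K := by
    rw [le_div_iff₀ hKR]
    refine hmain.trans ?_
    rw [hsplit]
    gcongr
  refine hI.trans ?_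
  rw [mul_add, add_div]
  refine add_le_add ?_ ?_
  · rw [div_le_div_iff₀ hKR hqR]
    nlinarith
  · rw [mul_div_assoc]
    gcongr
    rw [div_le_iff₀ hKR, ← Real.sqrt_sq hKR.le, ← Real.sqrt_mul (by positivity), Real.sqrt_sq hKR.le]
    apply Real.sqrt_le_sqrt
    calc 6 * K * D * q * (1 + Real.log q) ≤ 6 * K * D * (12 * N * K) * (1 + Real.log q) := by gcongr
      _ = _ := by ring

end

/-! ### Additive energies from representation counts. -/

section

variable {q : ℕ} [NeZero q]

/-- The additive autocorrelation of a weight on `ℤ/qℤ`. -/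
def autocorr (B : ZMod q → ℝ) (t : ZMod q) : ℝ := ∑ v, B (v + t) * B v

lemma autocorr_nonneg {B : ZMod q → ℝ} (hB : ∀ v, 0 ≤ B v) (t : ZMod q) : 0 ≤ autocorr B t :=
  Finset.sum_nonneg fun _ _ => mul_nonneg (hB _) (hB _)

lemma sum_autocorr (B : ZMod q → ℝ) : ∑ t, autocorr B t = (∑ v, B v) ^ 2 := by
  simp only [autocorr]
  rw [Finset.sum_comm, sq, Finset.mul_sum]
  refine Finset.sum_congr rfl fun v _ => ?_
  rw [← Finset.sum_mul]
  congr 1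
  exact Equiv.sum_comp (Equiv.addLeft v) B

lemma autocorr_zero_le {B : ZMod q → ℝ} (hB : ∀ v, 0 ≤ B v) {b : ℝ} (hb : ∀ v, B v ≤ b) :
    autocorr B 0 ≤ b * ∑ v, B v := by
  rw [autocorr, Finset.mul_sum]
  exact Finset.sum_le_sum fun v _ => mul_le_mul_of_nonneg_right (hb _) (hB v)

lemma autocorr_le {B : ZMod q → ℝ} (hB : ∀ v, 0 ≤ B v) {b : ℝ} (hb : ∀ v, B v ≤ b) {c : ZMod q}
    {N : ℕ} (hsupp : ∀ v, v ∉ rootSet q c N → B v = 0) (t : ZMod q) :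
    autocorr B t ≤ b ^ 2 * rootDiffCount q c N t := by
  rw [autocorr, rootDiffCount, mul_comm, ← nsmul_eq_mul, ← Finset.sum_const]
  rw [← Finset.sum_subset (Finset.subset_univ
    ((rootSet q c N).filter fun v => v + t ∈ rootSet q c N))]
  · refine Finset.sum_le_sum fun v _ => ?_
    rw [sq]
    exact mul_le_mul (hb _) (hb _) (hB _) ((hB v).trans (hb v))
  · intro v _ hv
    rw [Finset.mem_filter, not_and_or] at hv
    rcases hv with h | h
    · rw [hsupp v h, mul_zero]
    · rw [hsupp _ h, zero_mul]

/-- The term `t = 0` is at most `(b ∑ B)²`. For `t ≠ 0` one factor is bounded by `b²R`, and the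
other is summed to at most `(∑ B)²`. -/
lemma sum_sq_autocorr_le_of_count_le {B : ZMod q → ℝ} (hB : ∀ v, 0 ≤ B v) {b : ℝ}
    (hb : ∀ v, B v ≤ b) {c : ZMod q} {N : ℕ} (hsupp : ∀ v, v ∉ rootSet q c N → B v = 0)
    {R : ℝ} (hR : ∀ t, t ≠ 0 → (rootDiffCount q c N t : ℝ) ≤ R) (hR0 : 0 ≤ R) :
    ∑ t, autocorr B t ^ 2 ≤ b ^ 2 * (∑ v, B v) ^ 2 * (1 + R) := by
  rw [← Finset.add_sum_erase _ _ (Finset.mem_univ (0 : ZMod q)), mul_add, mul_one]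
  refine add_le_add ?_ ?_
  · rw [← mul_pow]
    exact pow_le_pow_left₀ (autocorr_nonneg hB 0) (autocorr_zero_le hB hb) 2
  · calc ∑ t ∈ Finset.univ.erase (0 : ZMod q), autocorr B t ^ 2
        ≤ ∑ t ∈ Finset.univ.erase (0 : ZMod q), autocorr B t * (b ^ 2 * R) := by
          refine Finset.sum_le_sum fun t ht => ?_
          rw [sq]
          refine mul_le_mul_of_nonneg_left ?_ (autocorr_nonneg hB t)
          refine (autocorr_le hB hb hsupp t).trans ?_
          have := hR t (Finset.mem_erase.1 ht).1
          gcongr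
      _ = (b ^ 2 * R) * ∑ t ∈ Finset.univ.erase (0 : ZMod q), autocorr B t := by
          rw [← Finset.sum_mul, mul_comm]
      _ ≤ (b ^ 2 * R) * ∑ t, autocorr B t := by
          gcongr
          · intro t _ _; exact autocorr_nonneg hB t
          · exact Finset.erase_subset _ _
      _ = _ := by rw [sum_autocorr]; ring

/-- Interpolation of `ℓ²` between `ℓ¹` and `ℓ⁴`, by Cauchy–Schwarz twice through the sum of cubes.
-/
lemma sum_sq_pow_three_le {ι : Type*} (s : Finset ι) {f : ι → ℝ} (hf : ∀ i, 0 ≤ f i) :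
    (∑ i ∈ s, f i ^ 2) ^ 3 ≤ (∑ i ∈ s, f i) ^ 2 * ∑ i ∈ s, f i ^ 4 := by
  set S₁ := ∑ i ∈ s, f i
  set S₂ := ∑ i ∈ s, f i ^ 2
  set S₃ := ∑ i ∈ s, f i ^ 3
  set S₄ := ∑ i ∈ s, f i ^ 4
  have h1 : 0 ≤ S₁ := Finset.sum_nonneg fun i _ => hf i
  have h2 : 0 ≤ S₂ := Finset.sum_nonneg fun i _ => pow_nonneg (hf i) 2
  have h4 : 0 ≤ S₄ := Finset.sum_nonneg fun i _ => pow_nonneg (hf i) 4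
  have e1 : S₂ ^ 2 ≤ S₁ * S₃ := Finset.sum_sq_le_sum_mul_sum_of_sq_le_mul s (fun i _ => hf i)
    (fun i _ => pow_nonneg (hf i) 3) fun i _ => le_of_eq (by ring)
  have e2 : S₃ ^ 2 ≤ S₂ * S₄ := Finset.sum_sq_le_sum_mul_sum_of_sq_le_mul s
    (fun i _ => pow_nonneg (hf i) 2) (fun i _ => pow_nonneg (hf i) 4) fun i _ => le_of_eq (by ring)
  rcases h2.eq_or_lt with h | h
  · rw [← h, zero_pow three_ne_zero]; positivity
  · have e3 : S₂ * S₂ ^ 3 ≤ S₂ * (S₁ ^ 2 * S₄) := by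
      calc S₂ * S₂ ^ 3 = (S₂ ^ 2) ^ 2 := by ring
        _ ≤ (S₁ * S₃) ^ 2 := by gcongr
        _ = S₁ ^ 2 * S₃ ^ 2 := by ring
        _ ≤ S₁ ^ 2 * (S₂ * S₄) := by gcongr
        _ = _ := by ring
    exact le_of_mul_le_mul_left e3 h

/-- Off `t = 0` this is the interpolation above, with `autocorr B t ≤ b² r(t)` in the fourth moment.
The moment bound is stated as a cube so that `G` itself appears after the cube root. -/
lemma sum_sq_autocorr_le_of_sum_count_le {B : ZMod q → ℝ} (hB : ∀ v, 0 ≤ B v) {b : ℝ}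
    (hb : ∀ v, B v ≤ b) {c : ZMod q} {N : ℕ} (hsupp : ∀ v, v ∉ rootSet q c N → B v = 0)
    {G : ℝ} (hG0 : 0 ≤ G)
    (hG : ∑ t ∈ Finset.univ.erase (0 : ZMod q), (rootDiffCount q c N t : ℝ) ^ 4 ≤ G ^ 3) :
    ∑ t, autocorr B t ^ 2 ≤ b ^ 2 * (∑ v, B v) ^ 2 +
      (∑ v, B v) ^ (4 / 3 : ℝ) * b ^ (8 / 3 : ℝ) * G := by
  have hb0 : 0 ≤ b := (hB 0).trans (hb 0)
  have hs0 : 0 ≤ ∑ v, B v := Finset.sum_nonneg fun v _ => hB v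
  rw [← Finset.add_sum_erase _ _ (Finset.mem_univ (0 : ZMod q))]
  refine add_le_add ?_ ?_
  · rw [← mul_pow]
    exact pow_le_pow_left₀ (autocorr_nonneg hB 0) (autocorr_zero_le hB hb) 2
  · refine le_of_pow_le_pow_left₀ (n := 3) (by norm_num) (by positivity) ?_
    refine (sum_sq_pow_three_le _ (autocorr_nonneg hB)).trans ?_
    have e1 : ∑ t ∈ Finset.univ.erase (0 : ZMod q), autocorr B t ≤ (∑ v, B v) ^ 2 := by
      rw [← sum_autocorr]
      exact Finset.sum_le_sum_of_subset_of_nonneg (Finset.erase_subset _ _)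
        fun t _ _ => autocorr_nonneg hB t
    have e2 : ∑ t ∈ Finset.univ.erase (0 : ZMod q), autocorr B t ^ 4 ≤ b ^ 8 * G ^ 3 := by
      calc _ ≤ ∑ t ∈ Finset.univ.erase (0 : ZMod q), b ^ 8 * (rootDiffCount q c N t : ℝ) ^ 4 := by
            refine Finset.sum_le_sum fun t _ => ?_
            calc _ ≤ (b ^ 2 * (rootDiffCount q c N t : ℝ)) ^ 4 :=
                  pow_le_pow_left₀ (autocorr_nonneg hB t) (autocorr_le hB hb hsupp t) 4
              _ = _ := by ring
        _ ≤ _ := by rw [← Finset.mul_sum]; gcongr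
    have e3 : ((∑ v, B v) ^ (4 / 3 : ℝ)) ^ 3 = (∑ v, B v) ^ 4 := by
      rw [← Real.rpow_natCast, ← Real.rpow_mul hs0, ← Real.rpow_natCast]; norm_num
    have e4 : (b ^ (8 / 3 : ℝ)) ^ 3 = b ^ 8 := by
      rw [← Real.rpow_natCast, ← Real.rpow_mul hb0, ← Real.rpow_natCast]; norm_num
    have e0 : 0 ≤ ∑ t ∈ Finset.univ.erase (0 : ZMod q), autocorr B t :=
      Finset.sum_nonneg fun t _ => autocorr_nonneg hB t
    have e5 : 0 ≤ ∑ t ∈ Finset.univ.erase (0 : ZMod q), autocorr B t ^ 4 :=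
      Finset.sum_nonneg fun t _ => pow_nonneg (autocorr_nonneg hB t) 4
    rw [mul_pow, mul_pow, e3, e4]
    calc _ ≤ ((∑ v, B v) ^ 2) ^ 2 * (b ^ 8 * G ^ 3) := by gcongr
      _ = _ := by ring

end

/-! ### Bilinear forms and additive energy. -/

section

variable {q : ℕ} [Fact q.Prime]

/-- Parseval's identity on `ℤ/qℤ`. -/
lemma sum_sq_norm_fourier (f : ZMod q → ℂ) :
    ∑ t : ZMod q, ‖∑ d, f d * ZMod.stdAddChar (t * d)‖ ^ 2 = q * ∑ d, ‖f d‖ ^ 2 := by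
  have h : ((∑ t : ZMod q, ‖∑ d, f d * ZMod.stdAddChar (t * d)‖ ^ 2 : ℝ) : ℂ) =
      ((q * ∑ d, ‖f d‖ ^ 2 : ℝ) : ℂ) := by
    push_cast
    simp only [← Complex.mul_conj', map_sum, map_mul, conj_stdAddChar, Finset.sum_mul_sum]
    rw [Finset.sum_comm, Finset.mul_sum]
    refine Finset.sum_congr rfl fun d _ => ?_
    rw [Finset.sum_comm]
    have : ∀ d' : ZMod q, ∑ t : ZMod q, f d * ZMod.stdAddChar (t * d) *
        ((starRingEnd ℂ) (f d') * ZMod.stdAddChar (-(t * d'))) =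
        if d' = d then q * (f d * (starRingEnd ℂ) (f d)) else 0 := by
      intro d'
      have e : ∀ t : ZMod q, f d * ZMod.stdAddChar (t * d) *
          ((starRingEnd ℂ) (f d') * ZMod.stdAddChar (-(t * d'))) =
          f d * (starRingEnd ℂ) (f d') * ZMod.stdAddChar (t * (d - d')) := by
        intro t
        rw [mul_sub, sub_eq_add_neg, AddChar.map_add_eq_mul]; ring
      rw [Finset.sum_congr rfl fun t _ => e t, ← Finset.mul_sum,
        AddChar.sum_mulShift _ (ZMod.isPrimitive_stdAddChar q)]
      by_cases h : d' = d
      · rw [if_pos h, if_pos (by rw [h, sub_self]), h, ZMod.card]; ring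
      · rw [if_neg h, if_neg (fun h' => h (sub_eq_zero.1 h').symm)]; simp
    rw [Finset.sum_congr rfl fun d' _ => this d', Finset.sum_ite_eq' Finset.univ d]
    simp
  exact_mod_cast h

/-- The squared modulus of a Fourier transform is the Fourier transform of the autocorrelation. -/
lemma sq_norm_fourier_eq (B : ZMod q → ℝ) (t : ZMod q) :
    ((‖∑ u, (B u : ℂ) * ZMod.stdAddChar (t * u)‖ ^ 2 : ℝ) : ℂ) =
      ∑ d, (autocorr B d : ℂ) * ZMod.stdAddChar (t * d) := by
  rw [Complex.ofReal_pow, ← Complex.mul_conj']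
  simp only [map_sum, map_mul, conj_stdAddChar, Complex.conj_ofReal]
  rw [mul_comm, Finset.sum_mul_sum]
  simp only [autocorr, Complex.ofReal_sum, Finset.sum_mul]
  rw [Finset.sum_comm (s := Finset.univ (α := ZMod q)) (γ := ZMod q)
    (f := fun d v => ((B (v + d) * B v : ℝ) : ℂ) * ZMod.stdAddChar (t * d))]
  refine Finset.sum_congr rfl fun v _ => ?_
  rw [← Equiv.sum_comp (Equiv.addLeft v)]
  refine Finset.sum_congr rfl fun d _ => ?_
  have : (ZMod.stdAddChar (t * d) : ℂ) = ZMod.stdAddChar (-(t * v)) * ZMod.stdAddChar (t * (v + d)) := by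
    rw [← AddChar.map_add_eq_mul]; congr 1; ring
  rw [this, Equiv.coe_addLeft]
  push_cast
  ring

lemma sum_pow_four_norm_fourier (B : ZMod q → ℝ) :
    ∑ t : ZMod q, ‖∑ u, (B u : ℂ) * ZMod.stdAddChar (t * u)‖ ^ 4 =
      q * ∑ d, autocorr B d ^ 2 := by
  have h := sum_sq_norm_fourier (fun d => (autocorr B d : ℂ))
  simp only [← sq_norm_fourier_eq, Complex.norm_real, Real.norm_eq_abs, sq_abs, ← pow_mul] at h
  exact h

/-- A bilinear form in additive characters is controlled by additive energies. -/
lemma norm_bilinear_pow_eight_le {h : ZMod q} (hh : h ≠ 0) (A B : ZMod q → ℂ) (U : Finset (ZMod q))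
    (hA : ∀ u, u ∉ U → A u = 0) :
    ‖∑ u, ∑ v, A u * B v * ZMod.stdAddChar (h * (u * v))‖ ^ 8 ≤
      (∑ u, ‖A u‖ ^ 2) ^ 4 * (∑ v, ‖B v‖) ^ 4 * (∑ t, autocorr (fun v => ‖B v‖) t ^ 2) *
        (q * ∑ t, autocorr (fun u => if u ∈ U then 1 else 0) t ^ 2) := by
  set IU : ZMod q → ℝ := fun u => if u ∈ U then 1 else 0 with hIU
  set R := autocorr (fun v => ‖B v‖) with hR
  have hR0 : ∀ t, 0 ≤ R t := autocorr_nonneg fun v => norm_nonneg _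
  set V : ZMod q → ℂ := fun u => ∑ v, B v * ZMod.stdAddChar (h * (u * v)) with hV
  set F : ZMod q → ℝ := fun t => ‖∑ u, (IU u : ℂ) * ZMod.stdAddChar (t * u)‖ with hF
  have step1 : ‖∑ u, ∑ v, A u * B v * ZMod.stdAddChar (h * (u * v))‖ ^ 2 ≤
      (∑ u, ‖A u‖ ^ 2) * ∑ u ∈ U, ‖V u‖ ^ 2 := by
    have e1 : ∑ u, ∑ v, A u * B v * ZMod.stdAddChar (h * (u * v)) = ∑ u ∈ U, A u * V u := by
      rw [Finset.sum_subset (Finset.subset_univ U) (fun u _ hu => by rw [hA u hu, zero_mul])]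
      refine Finset.sum_congr rfl fun u _ => ?_
      rw [hV, Finset.mul_sum]
      exact Finset.sum_congr rfl fun v _ => by ring
    rw [e1]
    calc _ ≤ (∑ u ∈ U, ‖A u‖ * ‖V u‖) ^ 2 := by
          gcongr
          exact (norm_sum_le _ _).trans_eq (Finset.sum_congr rfl fun u _ => norm_mul _ _)
      _ ≤ (∑ u ∈ U, ‖A u‖ ^ 2) * ∑ u ∈ U, ‖V u‖ ^ 2 := Finset.sum_mul_sq_le_sq_mul_sq _ _ _
      _ ≤ _ := by
          gcongr
          exact Finset.subset_univ U
  -- Writing the second variable of the opened square as `v + t` leaves the Fourier transform of the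
  -- indicator of `U` at `ht`, which depends on `t` alone, so `B` enters only through `R`.
  have step2 : ∑ u ∈ U, ‖V u‖ ^ 2 ≤ ∑ t, R t * F (h * t) := by
    have e1 : ((∑ u ∈ U, ‖V u‖ ^ 2 : ℝ) : ℂ) =
        ∑ v, ∑ t, B (v + t) * (starRingEnd ℂ) (B v) * ∑ u, (IU u : ℂ) * ZMod.stdAddChar (h * t * u) := by
      have e2 : ((∑ u ∈ U, ‖V u‖ ^ 2 : ℝ) : ℂ) = ∑ u, (IU u : ℂ) * (V u * (starRingEnd ℂ) (V u)) := by
        rw [Complex.ofReal_sum]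
        rw [← Finset.sum_subset (Finset.subset_univ U) (fun u _ hu => by simp [hIU, hu])]
        refine Finset.sum_congr rfl fun u hu => ?_
        rw [Complex.mul_conj']
        simp [hIU, hu]
      rw [e2]
      have e3 : ∀ u, V u * (starRingEnd ℂ) (V u) =
          ∑ v, ∑ t, B (v + t) * (starRingEnd ℂ) (B v) * ZMod.stdAddChar (h * t * u) := by
        intro u
        simp only [hV, map_sum, map_mul, conj_stdAddChar]
        rw [mul_comm, Finset.sum_mul_sum]
        refine Finset.sum_congr rfl fun v _ => ?_
        rw [← Equiv.sum_comp (Equiv.addLeft v)]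
        refine Finset.sum_congr rfl fun t _ => ?_
        have : (ZMod.stdAddChar (h * t * u) : ℂ) =
            ZMod.stdAddChar (-(h * (u * v))) * ZMod.stdAddChar (h * (u * (v + t))) := by
          rw [← AddChar.map_add_eq_mul]; congr 1; ring
        rw [this, Equiv.coe_addLeft]
        ring
      simp only [e3, Finset.mul_sum]
      rw [Finset.sum_comm]
      refine Finset.sum_congr rfl fun v _ => ?_
      rw [Finset.sum_comm]
      refine Finset.sum_congr rfl fun t _ => Finset.sum_congr rfl fun u _ => ?_
      ring
    have e4 : ∑ u ∈ U, ‖V u‖ ^ 2 = ‖((∑ u ∈ U, ‖V u‖ ^ 2 : ℝ) : ℂ)‖ := by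
      rw [Complex.norm_real, Real.norm_of_nonneg (by positivity)]
    rw [e4, e1]
    have e5 : ∑ t, R t * F (h * t) = ∑ v, ∑ t, ‖B (v + t)‖ * ‖B v‖ * F (h * t) := by
      rw [Finset.sum_comm]
      refine Finset.sum_congr rfl fun t _ => ?_
      rw [hR, autocorr, Finset.sum_mul]
    rw [e5]
    refine (norm_sum_le _ _).trans (Finset.sum_le_sum fun v _ => ?_)
    refine (norm_sum_le _ _).trans (Finset.sum_le_sum fun t _ => ?_)
    rw [norm_mul, norm_mul, RCLike.norm_conj]
  have step3 : (∑ t, R t * F (h * t)) ^ 2 ≤ (∑ v, ‖B v‖) ^ 2 * ∑ t, R t * F (h * t) ^ 2 := by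
    rw [← sum_autocorr (fun v => ‖B v‖)]
    exact Finset.sum_sq_le_sum_mul_sum_of_sq_le_mul _ (fun t _ => hR0 t)
      (fun t _ => mul_nonneg (hR0 t) (by positivity)) fun t _ => le_of_eq (by ring)
  -- Multiplication by `h` permutes the residues, so the sum of `F⁴` is `q` times the energy of `U`.
  have step4 : (∑ t, R t * F (h * t) ^ 2) ^ 2 ≤
      (∑ t, R t ^ 2) * (q * ∑ t, autocorr IU t ^ 2) := by
    rw [← sum_pow_four_norm_fourier]
    have e1 : ∑ t, F t ^ 4 = ∑ t, (F (h * t) ^ 2) ^ 2 := by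
      rw [← Equiv.sum_comp (Equiv.mulLeft₀ h hh)]
      exact Finset.sum_congr rfl fun t _ => pow_mul (F (h * t)) 2 2
    rw [show (∑ t, ‖∑ u, (IU u : ℂ) * ZMod.stdAddChar (t * u)‖ ^ 4) = ∑ t, F t ^ 4 from rfl, e1]
    exact Finset.sum_mul_sq_le_sq_mul_sq _ _ _
  have hn1 : 0 ≤ ∑ u ∈ U, ‖V u‖ ^ 2 := by positivity
  have hn3 : 0 ≤ ∑ t, R t * F (h * t) ^ 2 :=
    Finset.sum_nonneg fun t _ => mul_nonneg (hR0 t) (by positivity)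
  clear_value R F V
  calc _ = (‖∑ u, ∑ v, A u * B v * ZMod.stdAddChar (h * (u * v))‖ ^ 2) ^ 4 := by ring
    _ ≤ ((∑ u, ‖A u‖ ^ 2) * ∑ u ∈ U, ‖V u‖ ^ 2) ^ 4 := by gcongr
    _ ≤ ((∑ u, ‖A u‖ ^ 2) * ∑ t, R t * F (h * t)) ^ 4 := by gcongr
    _ = (∑ u, ‖A u‖ ^ 2) ^ 4 * ((∑ t, R t * F (h * t)) ^ 2) ^ 2 := by ring
    _ ≤ (∑ u, ‖A u‖ ^ 2) ^ 4 * ((∑ v, ‖B v‖) ^ 2 * ∑ t, R t * F (h * t) ^ 2) ^ 2 := by gcongr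
    _ = (∑ u, ‖A u‖ ^ 2) ^ 4 * (∑ v, ‖B v‖) ^ 4 * (∑ t, R t * F (h * t) ^ 2) ^ 2 := by ring
    _ ≤ (∑ u, ‖A u‖ ^ 2) ^ 4 * (∑ v, ‖B v‖) ^ 4 *
        ((∑ t, R t ^ 2) * (q * ∑ t, autocorr IU t ^ 2)) := by gcongr
    _ = _ := by ring

end

/-! ### Energies of weights supported on square roots. -/

section

variable {q : ℕ} [Fact q.Prime]

/-- The first bound for the energy of weights supported on square roots. -/
lemma sum_sq_autocorr_le_sup (hq2 : q ≠ 2) {c : ZMod q} (hc : c ≠ 0) {N : ℕ} (hN : 0 < N)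
    {D : ℝ} (hD1 : 1 ≤ D) (hD : ∀ n : ℕ, n ≠ 0 → n ≤ q ^ 2 → (n.divisors.card : ℝ) ≤ D)
    {B : ZMod q → ℝ} (hB : ∀ v, 0 ≤ B v) {b : ℝ} (hb : ∀ v, B v ≤ b)
    (hsupp : ∀ v, v ∉ rootSet q c N → B v = 0) :
    ∑ t, autocorr B t ^ 2 ≤
      100 * (D * (1 + Real.log q)) * (b ^ 2 * (∑ v, B v) ^ 2) * (N ^ 2 / q + √N) := by
  have hq1 : (1 : ℝ) ≤ q := by exact_mod_cast (Fact.out : q.Prime).pos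
  have hlog : 0 ≤ Real.log q := Real.log_nonneg hq1
  have hN1 : (1 : ℝ) ≤ N := by exact_mod_cast hN
  have hT : 1 ≤ D * (1 + Real.log q) := one_le_mul_of_one_le_of_one_le hD1 (by linarith)
  have h1 := sum_sq_autocorr_le_of_count_le hB hb hsupp
    (R := 96 * N ^ 2 / q + 4 * √(72 * D * N * (1 + Real.log q)))
    (fun t ht => by
      have e1 : (rootDiffCount q c N t : ℝ) ≤ (parabolaSet q (t ^ 2 * c⁻¹) N).card := by
        exact_mod_cast rootDiffCount_le_card_parabolaSet hq2 hc ht N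
      exact e1.trans (card_parabolaSet_le hq2 hN
        (mul_ne_zero (pow_ne_zero 2 ht) (inv_ne_zero hc)) hD1 hD)) (by positivity)
  refine h1.trans ?_
  set T := D * (1 + Real.log q) with hTdef
  have h2 : √(72 * D * N * (1 + Real.log q)) ≤ 9 * T * √N := by
    rw [show 72 * D * N * (1 + Real.log q) = 72 * T * N by rw [hTdef]; ring]
    rw [Real.sqrt_le_left (by positivity), mul_pow, Real.sq_sqrt (by positivity)]
    gcongr
    nlinarith
  have h3 : 1 ≤ √(N : ℝ) := Real.one_le_sqrt.2 hN1
  have h4 : 1 ≤ T * √N := one_le_mul_of_one_le_of_one_le hT h3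
  have h5 : (N : ℝ) ^ 2 / q ≤ T * (N ^ 2 / q) := le_mul_of_one_le_left (by positivity) hT
  have h6 : 0 ≤ T * ((N : ℝ) ^ 2 / q) := by positivity
  have h7 : 1 + (96 * (N : ℝ) ^ 2 / q + 4 * √(72 * D * N * (1 + Real.log q))) ≤
      100 * T * (N ^ 2 / q + √N) := by
    rw [mul_div_assoc]
    nlinarith
  calc _ ≤ b ^ 2 * (∑ v, B v) ^ 2 * (100 * T * (N ^ 2 / q + √N)) := by gcongr
    _ = _ := by ring

/-- With `y = √(N³/q)` the generic part of the moment is of size `N²(1 + y³)`. As `y³ = N Z³`, it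
becomes `N² + N³Z³`, and the whole moment is at most a constant times `T²N³(1 + Z³)`. -/
lemma sum_rootDiffCount_pow_four_le_pow_three (hq2 : q ≠ 2) {c : ZMod q} (hc : c ≠ 0) {N : ℕ}
    (hN : 0 < N) (hNq : 2 * N ≤ q) {D : ℝ} (hD1 : 1 ≤ D)
    (hD : ∀ n : ℕ, n ≠ 0 → n ≤ q ^ 2 → (n.divisors.card : ℝ) ≤ D) :
    ∑ t ∈ Finset.univ.erase (0 : ZMod q), (rootDiffCount q c N t : ℝ) ^ 4 ≤
      (100 * (D * (1 + Real.log q)) * N *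
        ((N : ℝ) ^ (7 / 6 : ℝ) / (q : ℝ) ^ (1 / 2 : ℝ) + 1)) ^ 3 := by
  have hq1 : (1 : ℝ) ≤ q := by exact_mod_cast (Fact.out : q.Prime).pos
  have hlog : 0 ≤ Real.log q := Real.log_nonneg hq1
  have hN1 : (1 : ℝ) ≤ N := by exact_mod_cast hN
  have hT : 1 ≤ D * (1 + Real.log q) := one_le_mul_of_one_le_of_one_le hD1 (by linarith)
  refine (sum_rootDiffCount_pow_four_le hq2 hc hN hNq hD1 hD).trans ?_
  set T := D * (1 + Real.log q) with hTdef
  set Z : ℝ := (N : ℝ) ^ (7 / 6 : ℝ) / (q : ℝ) ^ (1 / 2 : ℝ) with hZ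
  have hZ0 : 0 ≤ Z := by positivity
  set y : ℝ := √((N : ℝ) ^ 3 / q) with hy
  have hy0 : 0 ≤ y := Real.sqrt_nonneg _
  have hysq : y ^ 2 = (N : ℝ) ^ 3 / q := Real.sq_sqrt (by positivity)
  have hyZ : y ^ 3 = N * Z ^ 3 := by
    have e1 : y = Z * (N : ℝ) ^ (1 / 3 : ℝ) := by
      rw [hy, Real.sqrt_eq_rpow, Real.div_rpow (by positivity) (by positivity), hZ,
        div_mul_eq_mul_div, ← Real.rpow_add (by linarith), ← Real.rpow_natCast,
        ← Real.rpow_mul (by positivity)]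
      norm_num
    have e2 : ((N : ℝ) ^ (1 / 3 : ℝ)) ^ 3 = N := by
      rw [← Real.rpow_natCast, ← Real.rpow_mul (by positivity)]; norm_num
    rw [e1, mul_pow, e2, mul_comm]
  have hDT : D ≤ T := le_mul_of_one_le_right (by linarith) (by linarith)
  set A : ℝ := 8 * D * (1 + 64 * N ^ 3 / q) with hA
  have hA0 : 0 ≤ A := by positivity
  have hA1 : A ≤ 512 * T * (1 + y ^ 2) := by
    rw [hA, hysq]
    calc 8 * D * (1 + 64 * (N : ℝ) ^ 3 / q) ≤ 8 * T * (64 * (1 + N ^ 3 / q)) := by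
          gcongr
          rw [mul_add, mul_div_assoc]; linarith
      _ = _ := by ring
  have hA2 : √A ≤ 23 * T * (1 + y) := by
    rw [Real.sqrt_le_left (by positivity)]
    refine hA1.trans ?_
    calc 512 * T * (1 + y ^ 2) ≤ 529 * T ^ 2 * (1 + y) ^ 2 := by
          gcongr
          · norm_num
          · exact le_self_pow₀ hT two_ne_zero
          · nlinarith
      _ = _ := by ring
  have hAA : A * √A ≤ 23552 * T ^ 2 * (1 + y ^ 3) := by
    calc A * √A ≤ (512 * T * (1 + y ^ 2)) * (23 * T * (1 + y)) := by gcongr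
      _ = 11776 * T ^ 2 * ((1 + y ^ 2) * (1 + y)) := by ring
      _ ≤ 11776 * T ^ 2 * (2 * (1 + y ^ 3)) := by
          refine mul_le_mul_of_nonneg_left ?_ (by positivity)
          -- The difference of the two sides is `(1 - y)²(1 + y)`.
          nlinarith [mul_nonneg (sq_nonneg (1 - y)) (by linarith : 0 ≤ 1 + y)]
      _ = _ := by ring
  have hL : D ^ 2 * (1 + 2 * Real.log q) ^ 2 ≤ 4 * T ^ 2 := by
    calc D ^ 2 * (1 + 2 * Real.log q) ^ 2 ≤ D ^ 2 * (2 * (1 + Real.log q)) ^ 2 := by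
          gcongr; linarith
      _ = _ := by rw [hTdef]; ring
  have hN23 : (N : ℝ) ^ 2 ≤ N ^ 3 := pow_le_pow_right₀ hN1 (by norm_num)
  calc _ ≤ 4 * (N : ℝ) ^ 2 * (23552 * T ^ 2 * (1 + y ^ 3)) + 65536 * N ^ 3 * (4 * T ^ 2) := by
        refine add_le_add (by gcongr) ?_
        calc _ = 65536 * (N : ℝ) ^ 3 * (D ^ 2 * (1 + 2 * Real.log q) ^ 2) := by ring
          _ ≤ _ := by gcongr
    _ = 94208 * T ^ 2 * (N ^ 2 + N ^ 3 * Z ^ 3) + 262144 * T ^ 2 * N ^ 3 := by rw [hyZ]; ring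
    _ ≤ 94208 * T ^ 2 * (N ^ 3 + N ^ 3 * Z ^ 3) + 262144 * T ^ 2 * N ^ 3 := by gcongr
    _ = T ^ 2 * N ^ 3 * (356352 + 94208 * Z ^ 3) := by ring
    _ ≤ T ^ 3 * N ^ 3 * (1000000 * (Z + 1) ^ 3) := by
        gcongr
        · norm_num
        · nlinarith [pow_nonneg hZ0 3, pow_nonneg hZ0 2]
    _ = _ := by ring

/-- The second bound for the energy of weights supported on square roots. -/
lemma sum_sq_autocorr_le_moment (hq2 : q ≠ 2) {c : ZMod q} (hc : c ≠ 0) {N : ℕ} (hN : 0 < N)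
    (hNq : 2 * N ≤ q)
    {D : ℝ} (hD1 : 1 ≤ D) (hD : ∀ n : ℕ, n ≠ 0 → n ≤ q ^ 2 → (n.divisors.card : ℝ) ≤ D)
    {B : ZMod q → ℝ} (hB : ∀ v, 0 ≤ B v) {b : ℝ} (hb : ∀ v, B v ≤ b)
    (hsupp : ∀ v, v ∉ rootSet q c N → B v = 0) :
    ∑ t, autocorr B t ^ 2 ≤ 102 * (D * (1 + Real.log q)) *
      ((∑ v, B v) ^ (4 / 3 : ℝ) * b ^ (8 / 3 : ℝ)) *
        (N * ((N : ℝ) ^ (7 / 6 : ℝ) / (q : ℝ) ^ (1 / 2 : ℝ) + 1)) := by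
  have hq1 : (1 : ℝ) ≤ q := by exact_mod_cast (Fact.out : q.Prime).pos
  have hlog : 0 ≤ Real.log q := Real.log_nonneg hq1
  have hN1 : (1 : ℝ) ≤ N := by exact_mod_cast hN
  have hT : 1 ≤ D * (1 + Real.log q) := one_le_mul_of_one_le_of_one_le hD1 (by linarith)
  have h1 := sum_sq_autocorr_le_of_sum_count_le hB hb hsupp (by positivity)
    (sum_rootDiffCount_pow_four_le_pow_three hq2 hc hN hNq hD1 hD)
  refine h1.trans ?_
  have hb0 : 0 ≤ b := (hB 0).trans (hb 0)
  have hs0 : 0 ≤ ∑ v, B v := Finset.sum_nonneg fun v _ => hB v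
  -- This trivial bound lets the diagonal term `b²s²` be absorbed into `N s^(4/3) b^(8/3)`.
  have hs : ∑ v, B v ≤ 2 * N * b := by
    rw [← Finset.sum_subset (Finset.subset_univ (rootSet q c N)) (fun v _ hv => hsupp v hv)]
    calc ∑ v ∈ rootSet q c N, B v ≤ ∑ v ∈ rootSet q c N, b := Finset.sum_le_sum fun v _ => hb v
      _ = (rootSet q c N).card * b := by rw [Finset.sum_const, nsmul_eq_mul]
      _ ≤ _ := by gcongr; exact card_rootSet_le hc hNq
  set T := D * (1 + Real.log q)
  set Z : ℝ := (N : ℝ) ^ (7 / 6 : ℝ) / (q : ℝ) ^ (1 / 2 : ℝ) with hZ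
  have hZ0 : 0 ≤ Z := by positivity
  set s := ∑ v, B v
  have e1 : s ^ 2 = s ^ (4 / 3 : ℝ) * s ^ (2 / 3 : ℝ) := by
    rw [← Real.rpow_add_of_nonneg hs0 (by norm_num) (by norm_num), ← Real.rpow_natCast]; norm_num
  have e2 : b ^ (8 / 3 : ℝ) = b ^ 2 * b ^ (2 / 3 : ℝ) := by
    rw [← Real.rpow_natCast, ← Real.rpow_add_of_nonneg hb0 (by norm_num) (by norm_num)]; norm_num
  have e3 : s ^ (2 / 3 : ℝ) ≤ 2 * N * b ^ (2 / 3 : ℝ) := by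
    calc s ^ (2 / 3 : ℝ) ≤ (2 * N * b) ^ (2 / 3 : ℝ) := by gcongr
      _ = (2 * N) ^ (2 / 3 : ℝ) * b ^ (2 / 3 : ℝ) := Real.mul_rpow (by positivity) hb0
      _ ≤ (2 * N) ^ (1 : ℝ) * b ^ (2 / 3 : ℝ) := by
          gcongr
          · linarith
          · norm_num
      _ = _ := by rw [Real.rpow_one]
  have e4 : b ^ 2 * s ^ 2 ≤ 2 * N * (s ^ (4 / 3 : ℝ) * b ^ (8 / 3 : ℝ)) := by
    rw [e1, e2]
    calc _ ≤ b ^ 2 * (s ^ (4 / 3 : ℝ) * (2 * N * b ^ (2 / 3 : ℝ))) := by gcongr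
      _ = _ := by ring
  have e5 : 1 ≤ T * (Z + 1) := one_le_mul_of_one_le_of_one_le hT (by linarith)
  set E := s ^ (4 / 3 : ℝ) * b ^ (8 / 3 : ℝ) with hE
  have hE0 : 0 ≤ E := by positivity
  calc _ ≤ 2 * N * E * 1 + E * (100 * T * N * (Z + 1)) := by rw [mul_one]; gcongr
    _ ≤ 2 * N * E * (T * (Z + 1)) + E * (100 * T * N * (Z + 1)) := by gcongr
    _ = _ := by ring

/-! ### Averaging over twists by `c`. -/

/-- The weight `β` transported to the square roots of `bn`, `n ∼ N`. -/
noncomputable def rootWeight (q : ℕ) [NeZero q] (b : ZMod q) (N : ℕ) (β : ℕ → ℂ) (v : ZMod q) : ℂ :=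
  if v ∈ rootSet q b N then β (v ^ 2 * b⁻¹).val else 0

lemma sum_rootWeight_mul {b : ZMod q} (hb : b ≠ 0) {N : ℕ} (hNq : 2 * N ≤ q) (β : ℕ → ℂ)
    (f : ZMod q → ℂ) :
    ∑ v, rootWeight q b N β v * f v = ∑ n ∈ dyadic N, ∑ v : ZMod q with v ^ 2 = b * n, β n * f v := by
  rw [sum_rootSet hb hNq (fun n v => β n * f v),
    ← Finset.sum_subset (Finset.subset_univ (rootSet q b N))
      (fun v _ hv => by rw [rootWeight, if_neg hv, zero_mul])]
  exact Finset.sum_congr rfl fun v hv => by rw [rootWeight, if_pos hv]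

lemma sum_norm_rootWeight_le {b : ZMod q} (hb : b ≠ 0) {N : ℕ} (hNq : 2 * N ≤ q) (β : ℕ → ℂ) :
    ∑ v, ‖rootWeight q b N β v‖ ≤ 2 * weightNorm 1 N β := by
  rw [← Finset.sum_subset (Finset.subset_univ (rootSet q b N))
      (fun v _ hv => by rw [rootWeight, if_neg hv, norm_zero]),
    Finset.sum_congr rfl fun v hv => by rw [rootWeight, if_pos hv]]
  simpa [weightNorm] using sum_rootSet_le hb hNq (fun n => ‖β n‖) fun n => norm_nonneg _

lemma sum_sq_norm_rootWeight_le {b : ZMod q} (hb : b ≠ 0) {N : ℕ} (hNq : 2 * N ≤ q) (β : ℕ → ℂ) :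
    ∑ v, ‖rootWeight q b N β v‖ ^ 2 ≤ 2 * weightNorm 2 N β ^ 2 := by
  have h : weightNorm 2 N β ^ 2 = ∑ n ∈ dyadic N, ‖β n‖ ^ 2 := by
    rw [weightNorm, ← Real.rpow_natCast, ← Real.rpow_mul (by positivity)]
    norm_num
  rw [h, ← Finset.sum_subset (Finset.subset_univ (rootSet q b N))
      (fun v _ hv => by rw [rootWeight, if_neg hv, norm_zero, zero_pow two_ne_zero]),
    Finset.sum_congr rfl fun v hv => by rw [rootWeight, if_pos hv]]
  exact sum_rootSet_le hb hNq (fun n => ‖β n‖ ^ 2) fun n => by positivity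

lemma norm_rootWeight_le (b : ZMod q) (N : ℕ) (β : ℕ → ℂ) (v : ZMod q) :
    ‖rootWeight q b N β v‖ ≤ weightSupNorm N β := by
  rw [rootWeight, weightSupNorm]
  split_ifs with h
  · have : ‖β (v ^ 2 * b⁻¹).val‖₊ ≤ (dyadic N).sup fun m => ‖β m‖₊ :=
      Finset.le_sup (f := fun m => ‖β m‖₊) (Finset.mem_filter.1 h).2
    exact_mod_cast this
  · rw [norm_zero]; exact NNReal.coe_nonneg _

/-- A solution `z` together with any `u ≠ 0` determines `c = u²/x` and `v = z/u`, so every `z` is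
counted `q - 1` times. -/
lemma sum_twisted_sqrt {f : ZMod q → ℂ} {x y : ZMod q} (hx : x ≠ 0) :
    ∑ c ∈ Finset.univ.erase (0 : ZMod q), ∑ u : ZMod q with u ^ 2 = c * x,
      ∑ v : ZMod q with v ^ 2 = c⁻¹ * y, f (u * v) =
      ((q : ℂ) - 1) * ∑ z : ZMod q with z ^ 2 = x * y, f z := by
  have h1 : ((q : ℂ) - 1) * ∑ z : ZMod q with z ^ 2 = x * y, f z =
      ∑ u ∈ Finset.univ.erase (0 : ZMod q), ∑ z : ZMod q with z ^ 2 = x * y, f z := by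
    rw [Finset.sum_const, Finset.card_erase_of_mem (Finset.mem_univ _), Finset.card_univ, ZMod.card,
      nsmul_eq_mul, Nat.cast_sub (Fact.out : q.Prime).one_le, Nat.cast_one]
  rw [h1]
  simp only [Finset.sum_sigma']
  refine Finset.sum_bij' (fun p _ => ⟨p.2.1, p.2.1 * p.2.2⟩)
    (fun p _ => ⟨p.1 ^ 2 * x⁻¹, p.1, p.2 * p.1⁻¹⟩) ?_ ?_ ?_ ?_ ?_
  · rintro ⟨c, u, v⟩ hp
    simp only [Finset.mem_sigma, Finset.mem_erase, Finset.mem_univ, and_true, Finset.mem_filter,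
      true_and] at hp ⊢
    obtain ⟨hc, hu, hv⟩ := hp
    have hu2 : u ^ 2 ≠ 0 := by rw [hu]; exact mul_ne_zero hc hx
    refine ⟨fun h => hu2 (by rw [h, zero_pow two_ne_zero]), ?_⟩
    rw [mul_pow, hu, hv]
    field_simp
  · rintro ⟨u, z⟩ hp
    simp only [Finset.mem_sigma, Finset.mem_erase, Finset.mem_univ, and_true, Finset.mem_filter,
      true_and] at hp ⊢
    obtain ⟨hu, hz⟩ := hp
    refine ⟨mul_ne_zero (pow_ne_zero 2 hu) (inv_ne_zero hx), by field_simp, ?_⟩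
    rw [mul_pow, hz]
    field_simp
  · rintro ⟨c, u, v⟩ hp
    simp only [Finset.mem_sigma, Finset.mem_erase, Finset.mem_univ, and_true, Finset.mem_filter,
      true_and] at hp
    obtain ⟨hc, hu, hv⟩ := hp
    have hu2 : u ≠ 0 := by
      intro h
      rw [h, zero_pow two_ne_zero] at hu
      exact mul_ne_zero hc hx hu.symm
    simp only [Sigma.mk.injEq, heq_eq_eq, true_and]
    refine ⟨?_, ?_⟩
    · rw [hu]; field_simp
    · field_simp
  · rintro ⟨u, z⟩ hp
    simp only [Finset.mem_sigma, Finset.mem_erase, Finset.mem_univ, and_true, Finset.mem_filter,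
      true_and] at hp
    simp only [Sigma.mk.injEq, heq_eq_eq, true_and]
    have := hp.1
    field_simp
  · rintro ⟨c, u, v⟩ _
    rfl

end

section

variable {q : ℕ} [Fact q.Prime]

/-- `weylSqrtSum` is an average of bilinear forms over square roots. -/
lemma sum_bilinear_rootWeight {a h : ZMod q} (ha : a ≠ 0) (α β : ℕ → ℂ) {M N : ℕ} (hM : 0 < M)
    (hMq : 2 * M ≤ q) (hNq : 2 * N ≤ q) :
    ∑ c ∈ Finset.univ.erase (0 : ZMod q), ∑ u, ∑ v, rootWeight q (c * a) M α u *
      rootWeight q c⁻¹ N β v * ZMod.stdAddChar (h * (u * v)) =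
      ((q : ℂ) - 1) * weylSqrtSum q a h α β M N := by
  have h1 : ∀ c ∈ Finset.univ.erase (0 : ZMod q), (∑ u, ∑ v, rootWeight q (c * a) M α u *
      rootWeight q c⁻¹ N β v * (ZMod.stdAddChar (h * (u * v)) : ℂ)) =
      ∑ m ∈ dyadic M, ∑ n ∈ dyadic N, α m * β n * ∑ u : ZMod q with u ^ 2 = c * (a * m),
        ∑ v : ZMod q with v ^ 2 = c⁻¹ * n, (ZMod.stdAddChar (h * (u * v)) : ℂ) := by
    intro c hc
    have hc0 : c ≠ 0 := (Finset.mem_erase.1 hc).1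
    have e1 : ∀ u, ∑ v, rootWeight q (c * a) M α u *
        rootWeight q c⁻¹ N β v * (ZMod.stdAddChar (h * (u * v)) : ℂ) =
        rootWeight q (c * a) M α u * ∑ n ∈ dyadic N, ∑ v : ZMod q with v ^ 2 = c⁻¹ * n,
          β n * (ZMod.stdAddChar (h * (u * v)) : ℂ) := by
      intro u
      rw [← sum_rootWeight_mul (inv_ne_zero hc0) hNq β, Finset.mul_sum]
      exact Finset.sum_congr rfl fun v _ => by ring
    rw [Finset.sum_congr rfl fun u _ => e1 u, sum_rootWeight_mul (mul_ne_zero hc0 ha) hMq]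
    refine Finset.sum_congr rfl fun m _ => ?_
    simp only [Finset.mul_sum, mul_assoc]
    rw [Finset.sum_comm]
  rw [Finset.sum_congr rfl h1, Finset.sum_comm, weylSqrtSum, Finset.mul_sum]
  refine Finset.sum_congr rfl fun m hm => ?_
  rw [Finset.sum_comm, Finset.mul_sum]
  refine Finset.sum_congr rfl fun n _ => ?_
  have hm' : M ≤ m ∧ m < 2 * M := by simpa [dyadic] using hm
  have hm0 : (m : ZMod q) ≠ 0 := by
    rw [Ne, ZMod.natCast_eq_zero_iff]
    exact fun hd => absurd (Nat.le_of_dvd (hM.trans_le hm'.1) hd) (by omega)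
  rw [← Finset.mul_sum, sum_twisted_sqrt (f := fun z => ZMod.stdAddChar (h * z)) (mul_ne_zero ha hm0)]
  ring

lemma norm_weylSqrtSum_le_of_forall {a h : ZMod q} (ha : a ≠ 0) (α β : ℕ → ℂ) {M N : ℕ} (hM : 0 < M)
    (hMq : 2 * M ≤ q) (hNq : 2 * N ≤ q) {Y : ℝ}
    (hY : ∀ c : ZMod q, c ≠ 0 → ‖∑ u, ∑ v, rootWeight q (c * a) M α u *
      rootWeight q c⁻¹ N β v * ZMod.stdAddChar (h * (u * v))‖ ≤ Y) :
    ‖weylSqrtSum q a h α β M N‖ ≤ Y := by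
  have hq1 : (1 : ℝ) < q := by exact_mod_cast (Fact.out : q.Prime).one_lt
  have h1 := congrArg norm (sum_bilinear_rootWeight (h := h) ha α β hM hMq hNq)
  have h2 : ‖(q : ℂ) - 1‖ = q - 1 := by
    rw [show (q : ℂ) - 1 = ((q - 1 : ℝ) : ℂ) by push_cast; rfl, Complex.norm_real,
      Real.norm_of_nonneg (by linarith)]
  rw [norm_mul, h2] at h1
  have h3 : ((q : ℝ) - 1) * ‖weylSqrtSum q a h α β M N‖ ≤ (q - 1) * Y := by
    rw [← h1]
    refine (norm_sum_le _ _).trans ?_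
    calc _ ≤ ∑ c ∈ Finset.univ.erase (0 : ZMod q), Y :=
          Finset.sum_le_sum fun c hc => hY c (Finset.mem_erase.1 hc).1
      _ = _ := by
        rw [Finset.sum_const, Finset.card_erase_of_mem (Finset.mem_univ _), Finset.card_univ,
          ZMod.card, nsmul_eq_mul, Nat.cast_sub (Fact.out : q.Prime).one_le, Nat.cast_one]
  exact le_of_mul_le_mul_left h3 (by linarith)

/-- The eighth power of the bilinear form in terms of the norms of the weights and the energies. -/
lemma norm_bilinear_rootWeight_pow_eight_le {b c h : ZMod q} (hb : b ≠ 0) (hc : c ≠ 0) (hh : h ≠ 0)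
    (α β : ℕ → ℂ) {M N : ℕ} (hMq : 2 * M ≤ q) (hNq : 2 * N ≤ q) {E₁ E₂ : ℝ}
    (hE₁ : ∑ t, autocorr (fun v => ‖rootWeight q c N β v‖) t ^ 2 ≤ E₁)
    (hE₂ : ∑ t, autocorr (fun u => if u ∈ rootSet q b M then 1 else 0) t ^ 2 ≤ E₂) :
    ‖∑ u, ∑ v, rootWeight q b M α u * rootWeight q c N β v *
      ZMod.stdAddChar (h * (u * v))‖ ^ 8 ≤
      256 * weightNorm 2 M α ^ 8 * weightNorm 1 N β ^ 4 * E₁ * (q * E₂) := by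
  have h1 := norm_bilinear_pow_eight_le hh (rootWeight q b M α) (rootWeight q c N β)
    (rootSet q b M) (fun u hu => by rw [rootWeight, if_neg hu])
  have hE₁0 : 0 ≤ E₁ := le_trans (by positivity) hE₁
  refine h1.trans ?_
  calc _ ≤ (2 * weightNorm 2 M α ^ 2) ^ 4 * (2 * weightNorm 1 N β) ^ 4 * E₁ * (q * E₂) := by
        gcongr
        · exact sum_sq_norm_rootWeight_le hb hMq α
        · exact sum_norm_rootWeight_le hc hNq β
    _ = _ := by ring

lemma sum_indicator_rootSet_le {b : ZMod q} (hb : b ≠ 0) {M : ℕ} (hMq : 2 * M ≤ q) :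
    ∑ u, (if u ∈ rootSet q b M then (1 : ℝ) else 0) ≤ 2 * M := by
  simpa using card_rootSet_le hb hMq

end

/-! ### Assembly of the two bounds and the choice of parameters. -/

lemma rpow_pow_eight {x : ℝ} (hx : 0 ≤ x) (r s : ℝ) (h : r * 8 = s) : (x ^ r) ^ 8 = x ^ s := by
  rw [← Real.rpow_natCast, ← Real.rpow_mul hx, ← h]; norm_num

lemma rpow_div_rpow_add_one_pow_eight_ge {x y : ℝ} (hx : 0 ≤ x) (hy : 0 ≤ y) (r s r' s' : ℝ)
    (hr : r * 8 = r') (hs : s * 8 = s') : x ^ r' / y ^ s' + 1 ≤ (x ^ r / y ^ s + 1) ^ 8 := by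
  have h := pow_add_pow_le (x := x ^ r / y ^ s) (y := 1) (n := 8) (by positivity) zero_le_one
    (by norm_num)
  rwa [div_pow, rpow_pow_eight hx r r' hr, rpow_pow_eight hy s s' hs, one_pow] at h

/-- Each of the two energies loses a factor `T`, whence `T²`. The numerical constants that occur are
`256·408² = 6528²` and `256·400² = 6400²`, both below `7000²`. The exponent `8ε` becomes `ε` after
the eighth root. -/
lemma mul_sq_mul_le_rpow {K T x ε : ℝ} (hx : 0 < x) (hT : 0 ≤ T) (hK : K ≤ 7000 ^ 2)
    (h : 7000 * T ≤ x ^ (4 * ε)) : K * T ^ 2 * x ≤ x ^ (1 + 8 * ε) := by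
  calc K * T ^ 2 * x ≤ 7000 ^ 2 * T ^ 2 * x := by gcongr
    _ = (7000 * T) ^ 2 * x := by ring
    _ ≤ (x ^ (4 * ε)) ^ 2 * x := by gcongr
    _ = x ^ (1 + 8 * ε) := by
      rw [← Real.rpow_natCast, ← Real.rpow_mul hx.le, Real.rpow_add hx, Real.rpow_one, mul_comm]
      congr 2; push_cast; ring

lemma two_mul_rpow_four_thirds_le {x : ℝ} (hx : 0 ≤ x) :
    (2 * x) ^ (4 / 3 : ℝ) ≤ 4 * x ^ (4 / 3 : ℝ) := by
  rw [Real.mul_rpow (by norm_num) hx]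
  gcongr
  calc (2 : ℝ) ^ (4 / 3 : ℝ) ≤ 2 ^ (2 : ℝ) := by gcongr <;> norm_num
    _ = 4 := by norm_num

section

variable {q : ℕ} [Fact q.Prime]

lemma weightNorm_nonneg (σ : ℝ) (M : ℕ) (α : ℕ → ℂ) : 0 ≤ weightNorm σ M α := by
  unfold weightNorm; positivity

lemma weightSupNorm_nonneg (M : ℕ) (α : ℕ → ℂ) : 0 ≤ weightSupNorm M α := NNReal.coe_nonneg _

/-- Both energies are taken from the fourth-moment estimate. The eighth power then carries `‖β‖₁^(4
+ 4/3)`, `‖β‖_∞^(8/3)`, `M^(4/3 + 1)` and `N`, which explains the exponents. -/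
lemma norm_weylSqrtSum_le_moment (hq2 : q ≠ 2) {a h : ZMod q} (ha : a ≠ 0) (hh : h ≠ 0)
    {M N : ℕ} (hM : 0 < M) (hN : 0 < N) (hMq : 2 * M ≤ q) (hNq : 2 * N ≤ q) (α β : ℕ → ℂ)
    {D : ℝ} (hD1 : 1 ≤ D) (hD : ∀ n : ℕ, n ≠ 0 → n ≤ q ^ 2 → (n.divisors.card : ℝ) ≤ D)
    {ε : ℝ} (hε : 7000 * (D * (1 + Real.log q)) ≤ (q : ℝ) ^ (4 * ε)) :
    ‖weylSqrtSum q a h α β M N‖ ≤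
      weightNorm 2 M α * weightSupNorm N β ^ (1 / 3 : ℝ) * weightNorm 1 N β ^ (2 / 3 : ℝ) *
        (q : ℝ) ^ (1 / 8 + ε : ℝ) * (M : ℝ) ^ (7 / 24 : ℝ) * (N : ℝ) ^ (1 / 8 : ℝ) *
        ((M : ℝ) ^ (7 / 48 : ℝ) / (q : ℝ) ^ (1 / 16 : ℝ) + 1) *
        ((N : ℝ) ^ (7 / 48 : ℝ) / (q : ℝ) ^ (1 / 16 : ℝ) + 1) := by
  have hq0 : (0 : ℝ) < q := by exact_mod_cast (Fact.out : q.Prime).pos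
  have hM0 : (0 : ℝ) < M := by exact_mod_cast hM
  have hN0 : (0 : ℝ) < N := by exact_mod_cast hN
  have hlog : 0 ≤ Real.log q := Real.log_nonneg (by exact_mod_cast (Fact.out : q.Prime).pos)
  have hα := weightNorm_nonneg 2 M α
  have hβ := weightNorm_nonneg 1 N β
  have hβs := weightSupNorm_nonneg N β
  refine norm_weylSqrtSum_le_of_forall ha α β hM hMq hNq fun c hc => ?_
  refine le_of_pow_le_pow_left₀ (n := 8) (by norm_num) (by positivity) ?_
  have hca : c * a ≠ 0 := mul_ne_zero hc ha
  set T := D * (1 + Real.log q) with hT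
  have hT0 : 0 ≤ T := by positivity
  set zM := (M : ℝ) ^ (7 / 6 : ℝ) / (q : ℝ) ^ (1 / 2 : ℝ) with hzM
  set zN := (N : ℝ) ^ (7 / 6 : ℝ) / (q : ℝ) ^ (1 / 2 : ℝ) with hzN
  set β₁ := weightNorm 1 N β with hβ₁
  set βs := weightSupNorm N β with hβsdef
  have hE₁ : ∑ t, autocorr (fun v => ‖rootWeight q c⁻¹ N β v‖) t ^ 2 ≤
      102 * T * (4 * β₁ ^ (4 / 3 : ℝ) * βs ^ (8 / 3 : ℝ)) * (N * (zN + 1)) := by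
    refine (sum_sq_autocorr_le_moment hq2 (inv_ne_zero hc) hN hNq hD1 hD (fun v => norm_nonneg _)
      (norm_rootWeight_le c⁻¹ N β) (fun v hv => by rw [rootWeight, if_neg hv, norm_zero])).trans ?_
    have : (∑ v, ‖rootWeight q c⁻¹ N β v‖) ^ (4 / 3 : ℝ) ≤ 4 * β₁ ^ (4 / 3 : ℝ) :=
      (Real.rpow_le_rpow (by positivity) (sum_norm_rootWeight_le (inv_ne_zero hc) hNq β)
        (by norm_num)).trans (two_mul_rpow_four_thirds_le hβ)
    gcongr
  have hE₂ : ∑ t, autocorr (fun u => if u ∈ rootSet q (c * a) M then 1 else 0) t ^ 2 ≤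
      102 * T * (4 * (M : ℝ) ^ (4 / 3 : ℝ)) * (M * (zM + 1)) := by
    refine (sum_sq_autocorr_le_moment hq2 hca hM hMq hD1 hD (b := 1)
      (fun v => by split_ifs <;> norm_num) (fun v => by split_ifs <;> norm_num)
      (fun v hv => if_neg hv)).trans ?_
    rw [Real.one_rpow, mul_one]
    have : (∑ u, (if u ∈ rootSet q (c * a) M then (1 : ℝ) else 0)) ^ (4 / 3 : ℝ) ≤
        4 * (M : ℝ) ^ (4 / 3 : ℝ) :=
      (Real.rpow_le_rpow (Finset.sum_nonneg fun u _ => by split_ifs <;> norm_num)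
        (sum_indicator_rootSet_le hca hMq) (by norm_num)).trans (two_mul_rpow_four_thirds_le hM0.le)
    gcongr
  have hmain := norm_bilinear_rootWeight_pow_eight_le hca (inv_ne_zero hc) hh α β hMq hNq hE₁ hE₂
  rw [← hβ₁] at hmain
  refine hmain.trans ?_
  have hgM := rpow_div_rpow_add_one_pow_eight_ge hM0.le hq0.le (7 / 48) (1 / 16) (7 / 6) (1 / 2)
    (by norm_num) (by norm_num)
  have hgN := rpow_div_rpow_add_one_pow_eight_ge hN0.le hq0.le (7 / 48) (1 / 16) (7 / 6) (1 / 2)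
    (by norm_num) (by norm_num)
  rw [← hzM] at hgM
  rw [← hzN] at hgN
  have hqe : 256 * 408 ^ 2 * T ^ 2 * q ≤ (q : ℝ) ^ (1 + 8 * ε) :=
    mul_sq_mul_le_rpow hq0 hT0 (by norm_num) hε
  simp only [mul_pow]
  rw [rpow_pow_eight hβs _ (8 / 3) (by norm_num), rpow_pow_eight hβ _ (16 / 3) (by norm_num),
    rpow_pow_eight hq0.le _ (1 + 8 * ε) (by ring), rpow_pow_eight hM0.le _ (7 / 3) (by norm_num),
    rpow_pow_eight hN0.le _ 1 (by norm_num), Real.rpow_one]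
  have e1 : β₁ ^ (16 / 3 : ℝ) = β₁ ^ 4 * β₁ ^ (4 / 3 : ℝ) := by
    rw [← Real.rpow_natCast, ← Real.rpow_add_of_nonneg hβ (by norm_num) (by norm_num)]; norm_num
  have e2 : (M : ℝ) ^ (7 / 3 : ℝ) = M ^ (4 / 3 : ℝ) * M := by
    nth_rewrite 3 [← Real.rpow_one (M : ℝ)]
    rw [← Real.rpow_add hM0]; norm_num
  rw [e1, e2]
  have hzM0 : 0 ≤ zM := by positivity
  have hzN0 : 0 ≤ zN := by positivity
  clear_value zM zN β₁ βs T
  set A := weightNorm 2 M α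
  clear_value A
  calc _ = A ^ 8 * βs ^ (8 / 3 : ℝ) * (β₁ ^ 4 * β₁ ^ (4 / 3 : ℝ)) * (256 * 408 ^ 2 * T ^ 2 * q) *
        ((M : ℝ) ^ (4 / 3 : ℝ) * M) * N * (zM + 1) * (zN + 1) := by ring
    _ ≤ _ := by gcongr

/-- Both energies are taken from the pointwise estimate. The eighth power then carries `‖β‖₁^(4 +
2)`, `‖β‖_∞²`, `M^(2 + 1/2)` and `N^(1/2)`. -/
lemma norm_weylSqrtSum_le_sup (hq2 : q ≠ 2) {a h : ZMod q} (ha : a ≠ 0) (hh : h ≠ 0)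
    {M N : ℕ} (hM : 0 < M) (hN : 0 < N) (hMq : 2 * M ≤ q) (hNq : 2 * N ≤ q) (α β : ℕ → ℂ)
    {D : ℝ} (hD1 : 1 ≤ D) (hD : ∀ n : ℕ, n ≠ 0 → n ≤ q ^ 2 → (n.divisors.card : ℝ) ≤ D)
    {ε : ℝ} (hε : 7000 * (D * (1 + Real.log q)) ≤ (q : ℝ) ^ (4 * ε)) :
    ‖weylSqrtSum q a h α β M N‖ ≤
      weightNorm 2 M α * weightNorm 1 N β ^ (3 / 4 : ℝ) * weightSupNorm N β ^ (1 / 4 : ℝ) *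
        (q : ℝ) ^ (1 / 8 + ε : ℝ) * (M : ℝ) ^ (5 / 16 : ℝ) * (N : ℝ) ^ (1 / 16 : ℝ) *
        ((M : ℝ) ^ (3 / 16 : ℝ) / (q : ℝ) ^ (1 / 8 : ℝ) + 1) *
        ((N : ℝ) ^ (3 / 16 : ℝ) / (q : ℝ) ^ (1 / 8 : ℝ) + 1) := by
  have hq0 : (0 : ℝ) < q := by exact_mod_cast (Fact.out : q.Prime).pos
  have hM0 : (0 : ℝ) < M := by exact_mod_cast hM
  have hN0 : (0 : ℝ) < N := by exact_mod_cast hN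
  have hlog : 0 ≤ Real.log q := Real.log_nonneg (by exact_mod_cast (Fact.out : q.Prime).pos)
  have hα := weightNorm_nonneg 2 M α
  have hβ := weightNorm_nonneg 1 N β
  have hβs := weightSupNorm_nonneg N β
  refine norm_weylSqrtSum_le_of_forall ha α β hM hMq hNq fun c hc => ?_
  refine le_of_pow_le_pow_left₀ (n := 8) (by norm_num) (by positivity) ?_
  have hca : c * a ≠ 0 := mul_ne_zero hc ha
  set T := D * (1 + Real.log q) with hT
  have hT0 : 0 ≤ T := by positivity
  set β₁ := weightNorm 1 N β with hβ₁
  set βs := weightSupNorm N β with hβsdef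
  have hE₁ : ∑ t, autocorr (fun v => ‖rootWeight q c⁻¹ N β v‖) t ^ 2 ≤
      100 * T * (βs ^ 2 * (2 * β₁) ^ 2) * ((N : ℝ) ^ 2 / q + √N) := by
    refine (sum_sq_autocorr_le_sup hq2 (inv_ne_zero hc) hN hD1 hD (fun v => norm_nonneg _)
      (norm_rootWeight_le c⁻¹ N β) (fun v hv => by rw [rootWeight, if_neg hv, norm_zero])).trans ?_
    have := sum_norm_rootWeight_le (inv_ne_zero hc) hNq β
    gcongr
  have hE₂ : ∑ t, autocorr (fun u => if u ∈ rootSet q (c * a) M then 1 else 0) t ^ 2 ≤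
      100 * T * (2 * (M : ℝ)) ^ 2 * ((M : ℝ) ^ 2 / q + √M) := by
    refine (sum_sq_autocorr_le_sup hq2 hca hM hD1 hD (b := 1)
      (fun v => by split_ifs <;> norm_num) (fun v => by split_ifs <;> norm_num)
      (fun v hv => if_neg hv)).trans ?_
    rw [one_pow, one_mul]
    have h1 := sum_indicator_rootSet_le hca hMq
    have h2 : 0 ≤ ∑ u, (if u ∈ rootSet q (c * a) M then (1 : ℝ) else 0) :=
      Finset.sum_nonneg fun u _ => by split_ifs <;> norm_num
    gcongr
  have hmain := norm_bilinear_rootWeight_pow_eight_le hca (inv_ne_zero hc) hh α β hMq hNq hE₁ hE₂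
  rw [← hβ₁] at hmain
  refine hmain.trans ?_
  have hgM := rpow_div_rpow_add_one_pow_eight_ge hM0.le hq0.le (3 / 16) (1 / 8) (3 / 2) 1
    (by norm_num) (by norm_num)
  have hgN := rpow_div_rpow_add_one_pow_eight_ge hN0.le hq0.le (3 / 16) (1 / 8) (3 / 2) 1
    (by norm_num) (by norm_num)
  rw [Real.rpow_one] at hgM hgN
  have hsplit : ∀ x : ℝ, 0 < x → x ^ 2 / q + √x = x ^ (1 / 2 : ℝ) * (x ^ (3 / 2 : ℝ) / q + 1) := by
    intro x hx
    rw [mul_add, mul_one, ← mul_div_assoc, ← Real.rpow_add hx, Real.sqrt_eq_rpow,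
      ← Real.rpow_natCast]
    norm_num
  rw [hsplit _ hM0, hsplit _ hN0]
  have hqe : 256 * 400 ^ 2 * T ^ 2 * q ≤ (q : ℝ) ^ (1 + 8 * ε) :=
    mul_sq_mul_le_rpow hq0 hT0 (by norm_num) hε
  simp only [mul_pow]
  rw [rpow_pow_eight hβs _ (2 : ℕ) (by norm_num), rpow_pow_eight hβ _ (6 : ℕ) (by norm_num),
    rpow_pow_eight hq0.le _ (1 + 8 * ε) (by ring), rpow_pow_eight hM0.le _ (5 / 2) (by norm_num),
    rpow_pow_eight hN0.le _ (1 / 2) (by norm_num), Real.rpow_natCast, Real.rpow_natCast]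
  have e2 : (M : ℝ) ^ (5 / 2 : ℝ) = M ^ 2 * M ^ (1 / 2 : ℝ) := by
    rw [← Real.rpow_natCast, ← Real.rpow_add hM0]; norm_num
  rw [e2]
  set yM := (M : ℝ) ^ (3 / 2 : ℝ) / (q : ℝ) with hyM
  set yN := (N : ℝ) ^ (3 / 2 : ℝ) / (q : ℝ) with hyN
  have hyM0 : 0 ≤ yM := by positivity
  have hyN0 : 0 ≤ yN := by positivity
  clear_value yM yN β₁ βs T
  set A := weightNorm 2 M α
  clear_value A
  calc _ = A ^ 8 * β₁ ^ 6 * βs ^ 2 * (256 * 400 ^ 2 * T ^ 2 * q) *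
        ((M : ℝ) ^ 2 * (M : ℝ) ^ (1 / 2 : ℝ)) * (N : ℝ) ^ (1 / 2 : ℝ) * (yM + 1) * (yN + 1) := by ring
    _ ≤ _ := by gcongr

end

/-- Logarithms and constants are absorbed by powers. -/
lemma exists_forall_mul_log_le_rpow (C : ℝ) {ε : ℝ} (hε : 0 < ε) :
    ∃ q₀ : ℕ, ∀ q : ℕ, q₀ ≤ q → C * (1 + Real.log q) ≤ (q : ℝ) ^ ε := by
  have h1 : (fun x : ℝ => C * (1 + Real.log x)) =o[Filter.atTop] fun x : ℝ => x ^ ε :=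
    (((Asymptotics.isLittleO_const_left.2 (Or.inr
      (tendsto_norm_atTop_atTop.comp (tendsto_rpow_atTop hε)))).add
      (isLittleO_log_rpow_atTop hε)).const_mul_left C)
  have h2 := (h1.comp_tendsto tendsto_natCast_atTop_atTop).bound one_pos
  obtain ⟨q₀, hq₀⟩ := Filter.eventually_atTop.1 h2
  refine ⟨q₀, fun q hq => ?_⟩
  have h3 := hq₀ q hq
  simp only [Function.comp_apply, one_mul, Real.norm_eq_abs] at h3
  rw [abs_of_nonneg (a := (q : ℝ) ^ ε) (by positivity)] at h3
  exact (le_abs_self _).trans h3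

theorem mainTheorem4 :
    ∀ ε : ℝ, 0 < ε → ∃ q₀ : ℕ, ∀ (q : ℕ) [Fact q.Prime], q₀ ≤ q →
      ∀ (a h : ZMod q), a ≠ 0 → h ≠ 0 →
      ∀ (M N : ℕ), 0 < M → 0 < N → (M : ℝ) ≤ (q : ℝ) / 2 → (N : ℝ) ≤ (q : ℝ) / 2 →
      ∀ (α β : ℕ → ℂ),
        ‖weylSqrtSum q a h α β M N‖ ≤
            weightNorm 2 M α * weightSupNorm N β ^ (1 / 3 : ℝ) * weightNorm 1 N β ^ (2 / 3 : ℝ) *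
              (q : ℝ) ^ (1 / 8 + ε : ℝ) * (M : ℝ) ^ (7 / 24 : ℝ) * (N : ℝ) ^ (1 / 8 : ℝ) *
              ((M : ℝ) ^ (7 / 48 : ℝ) / (q : ℝ) ^ (1 / 16 : ℝ) + 1) *
              ((N : ℝ) ^ (7 / 48 : ℝ) / (q : ℝ) ^ (1 / 16 : ℝ) + 1) ∧
        ‖weylSqrtSum q a h α β M N‖ ≤
            weightNorm 2 M α * weightNorm 1 N β ^ (3 / 4 : ℝ) * weightSupNorm N β ^ (1 / 4 : ℝ) *
              (q : ℝ) ^ (1 / 8 + ε : ℝ) * (M : ℝ) ^ (5 / 16 : ℝ) * (N : ℝ) ^ (1 / 16 : ℝ) *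
              ((M : ℝ) ^ (3 / 16 : ℝ) / (q : ℝ) ^ (1 / 8 : ℝ) + 1) *
              ((N : ℝ) ^ (3 / 16 : ℝ) / (q : ℝ) ^ (1 / 8 : ℝ) + 1) := by
  intro ε hε
  obtain ⟨C, hC1, hC⟩ := exists_card_divisors_le ε hε
  -- Divisors are counted for integers up to `q²`, so `D = C q^(2ε)`; a further `q^(2ε)` absorbs the
  -- logarithm and the constants, for a total of `q^(4ε)`.
  obtain ⟨q₁, hq₁⟩ := exists_forall_mul_log_le_rpow (7000 * C) (ε := 2 * ε) (by linarith)
  -- The `3` excludes `q = 2`, where `2s` is not invertible.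
  refine ⟨max q₁ 3, fun q _ hq a h ha hh M N hM hN hMq hNq α β => ?_⟩
  have hq3 : 3 ≤ q := (le_max_right _ _).trans hq
  have hq1 : (1 : ℝ) ≤ q := by exact_mod_cast (by omega : 1 ≤ q)
  have hq2 : q ≠ 2 := by omega
  have hM2 : 2 * M ≤ q := by
    have : 2 * (M : ℝ) ≤ q := by linarith
    exact_mod_cast this
  have hN2 : 2 * N ≤ q := by
    have : 2 * (N : ℝ) ≤ q := by linarith
    exact_mod_cast this
  have hD1 : 1 ≤ C * (q : ℝ) ^ (2 * ε) :=
    one_le_mul_of_one_le_of_one_le hC1 (Real.one_le_rpow hq1 (by linarith))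
  have hD : ∀ n : ℕ, n ≠ 0 → n ≤ q ^ 2 → (n.divisors.card : ℝ) ≤ C * (q : ℝ) ^ (2 * ε) := by
    intro n hn hnq
    refine (hC n hn).trans ?_
    gcongr
    calc (n : ℝ) ^ ε ≤ ((q : ℝ) ^ 2) ^ ε := by
          gcongr
          exact_mod_cast hnq
      _ = _ := by rw [← Real.rpow_natCast, ← Real.rpow_mul (by positivity)]; norm_num
  have hQ : 7000 * (C * (q : ℝ) ^ (2 * ε) * (1 + Real.log q)) ≤ (q : ℝ) ^ (4 * ε) := by
    have h1 := hq₁ q ((le_max_left _ _).trans hq)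
    calc _ = (q : ℝ) ^ (2 * ε) * (7000 * C * (1 + Real.log q)) := by ring
      _ ≤ (q : ℝ) ^ (2 * ε) * (q : ℝ) ^ (2 * ε) := by gcongr
      _ = _ := by rw [← Real.rpow_add (by linarith)]; congr 1; ring
  exact ⟨norm_weylSqrtSum_le_moment hq2 ha hh hM hN hM2 hN2 α β hD1 hD hQ,
    norm_weylSqrtSum_le_sup hq2 ha hh hM hN hM2 hN2 α β hD1 hD hQ⟩
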